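/- Let $\mathcal A$ be a finite alphabet, $\mu$ a probability measure on $\mathcal A$ with $\mu(a)>0$ for all $a$, and let $x_1,x_2,\dots,y_1,y_2,\dots$ be independent $\mathcal A$-valued random variables, all with law $\mu$; write $\mathbf x_m=x_1\cdots x_m$ and $\mathbf y_n=y_1\cdots y_n$. Let $K:\mathcal A\times\mathcal A\to\mathbb R$ be symmetric with $E[K(x_1,y_1)]<0$ and $\max_{a,b}K(a,b)>0$. Let $g:\{0,1,2,\dots\}\to[0,\infty)$ be nondecreasing and concave (that is, $g(k+1)-g(k)\le g(k)-g(k-1)$ for $k\ge1$) with $g(0)=0$ and $\lim_{k\to\infty}g(k)/\log k=\infty$. A candidate alignment is a nonempty finite set $\mathbf z=\{(i(t),j(t)):1\le t\le u\}$ of pairs of positive integers with $i(1)<\dots<i(u)$ and $j(1)<\dots<j(u)$; $|\mathbf z|=u$ is its number of matches. Let $$S_{\mathbf z}(\mathbf x_m,\mathbf y_n)=\sum_{t=1}^{u}K(x_{i(t)},y_{j(t)})-\sum_{t=1}^{u-1}\bigl[g(i(t+1)-i(t)-1)+g(j(t+1)-j(t)-1)\bigr]$$ if $i(u)\le m$ and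 $j(u)\le n$, and $S_{\mathbf z}(\mathbf x_m,\mathbf y_n)=-\infty$ otherwise; let $H(\mathbf x_m,\mathbf y_n)=\sup_{\mathbf z}S_{\mathbf z}(\mathbf x_m,\mathbf y_n)$ be the local alignment score, and $$R_{\mathbf z}(\mathbf x_m,\mathbf y_n)=S_{\mathbf z}(\mathbf x_m,\mathbf y_n)-g(i(1)-1)-g(j(1)-1)-g(m-i(u))-g(n-j(u)).$$ For $\kappa\ge1$ and $m,n\ge\kappa$ let $G_\kappa(\mathbf x_m,\mathbf y_n)$ be the maximum of $R_{\mathbf z}(\mathbf x_m,\mathbf y_n)$ over the alignments $\mathbf z$ with $(1,1)\in\mathbf z$ and $|\mathbf z|=\kappa$. For $\theta>0$ let $$h_\kappa(\theta)=\sum_{m,n\ge\kappa}E\exp[\theta G_\kappa(\mathbf x_m,\mathbf y_n)],\qquad \psi_\kappa(\theta)=\log h_\kappa(\theta),\qquad \psi(\theta)=\lim_{\kappa\to\infty}\psi_\kappa(\theta)/\kappa .$$ Fix a total ordering of all candidate alignments, and for each $n\ge1$ let $\mathbf z_*$ be the smallest alignment $\mathbf z$ in this ordering with $S_{\mathbf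 z}(\mathbf x_n,\mathbf y_n)=H(\mathbf x_n,\mathbf y_n)$. Then $\psi$ is well defined and finite on $(0,\infty)$ (all $h_\kappa(\theta)$ are finite and the limit exists). Moreover, if the equation $\psi(\theta)=0$ has a unique positive root $\tilde\theta$ and $\psi$ is differentiable at $\tilde\theta$, then $\psi'(\tilde\theta)>0$ and $$\frac{|\mathbf z_*|}{\log n}\longrightarrow\frac{2}{\tilde\theta\,\psi'(\tilde\theta)}\quad\text{almost surely as } n\to\infty .$$ -/

import Mathlib

open MeasureTheory ProbabilityTheory Filter Topology

noncomputable section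

namespace LocalAlignment

/-- A nonempty candidate alignment `z = {(i(1), j(1)), …, (i(u), j(u))}` with `i(1) < ⋯ < i(u)` and
`j(1) < ⋯ < j(u)`, as the list of its pairs. Positions in a sequence are counted from `0`: the pair
`(i, j)` matches the letters `x i` and `y j`, and the first `m` letters of `x` are
`x 0, …, x (m - 1)`. -/
structure Alignment where
  pairs : List (ℕ × ℕ)
  nonempty : pairs ≠ []
  increasing : pairs.Pairwise fun p q => p.1 < q.1 ∧ p.2 < q.2

namespace Alignment

/-- The number of matches `|z|`. -/
def card (z : Alignment) : ℕ := z.pairs.length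

/-- The first pair of `z`. -/
def first (z : Alignment) : ℕ × ℕ := z.pairs.head z.nonempty

/-- The last pair of `z`. -/
def last (z : Alignment) : ℕ × ℕ := z.pairs.getLast z.nonempty

/-- All pairs of `z` lie within the first `m` letters of `x` and the first `n` letters of `y`. -/
def Fits (z : Alignment) (m n : ℕ) : Prop := z.last.1 < m ∧ z.last.2 < n

/-- The alignment whose only pair consists of the two initial positions. -/
def single : Alignment := ⟨[(0, 0)], by simp, by simp⟩

end Alignment

/-- The total penalty of the gaps between consecutive pairs: the sum over `t < u` of
`g (i(t+1) - i(t) - 1) + g (j(t+1) - j(t) - 1)`. -/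
def gapPenalty (g : ℕ → ℝ) : List (ℕ × ℕ) → ℝ
  | [] => 0
  | [_] => 0
  | p :: q :: l => g (q.1 - p.1 - 1) + g (q.2 - p.2 - 1) + gapPenalty g (q :: l)

variable {A : Type*}

open Classical in
/-- The score `S_z(x_m, y_n)`: similarity scores of the matched letters minus the penalties of the
gaps between matches; it is `-∞` if `z` does not fit into the first `m` letters of `x` and the
first `n` letters of `y`. -/
def localScore (K : A → A → ℝ) (g : ℕ → ℝ) (x y : ℕ → A) (m n : ℕ) (z : Alignment) : EReal :=
  if z.Fits m n then
    (((z.pairs.map fun p => K (x p.1) (y p.2)).sum - gapPenalty g z.pairs : ℝ) : EReal)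
  else ⊥

/-- The local alignment score `H(x_m, y_n)`. -/
def H (K : A → A → ℝ) (g : ℕ → ℝ) (x y : ℕ → A) (m n : ℕ) : EReal :=
  ⨆ z : Alignment, localScore K g x y m n z

/-- The score `R_z(x_m, y_n)`, where the unaligned letters before the first match and after the
last match are penalized as well. -/
def globalScore (K : A → A → ℝ) (g : ℕ → ℝ) (x y : ℕ → A) (m n : ℕ) (z : Alignment) : EReal :=
  localScore K g x y m n z -
    ((g z.first.1 + g z.first.2 + g (m - 1 - z.last.1) + g (n - 1 - z.last.2) : ℝ) : EReal)

/-- `G_κ(x_m, y_n)`: the maximum of `R_z(x_m, y_n)` over all alignments `z` with exactly `κ`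
matches, one of which is the match of the two initial letters. It is a real number when
`m, n ≥ κ ≥ 1`. -/
def G (K : A → A → ℝ) (g : ℕ → ℝ) (κ : ℕ) (x y : ℕ → A) (m n : ℕ) : EReal :=
  ⨆ z ∈ {z : Alignment | (0, 0) ∈ z.pairs ∧ z.card = κ}, globalScore K g x y m n z

variable {Ω : Type*} [MeasurableSpace Ω]

/-- `E exp [θ G_κ(x_m, y_n)]` for the random sequences `X`, `Y`. -/
def expMoment (P : Measure Ω) (X Y : ℕ → Ω → A) (K : A → A → ℝ) (g : ℕ → ℝ)
    (κ m n : ℕ) (θ : ℝ) : ℝ :=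
  ∫ ω, Real.exp (θ * (G K g κ (fun i => X i ω) (fun j => Y j ω) m n).toReal) ∂P

/-- `h_κ(θ)`, the sum of `E exp [θ G_κ(x_m, y_n)]` over all `m, n ≥ κ`. -/
def h (P : Measure Ω) (X Y : ℕ → Ω → A) (K : A → A → ℝ) (g : ℕ → ℝ) (κ : ℕ) (θ : ℝ) : ℝ :=
  ∑' r : ℕ × ℕ, expMoment P X Y K g κ (κ + r.1) (κ + r.2) θ

/-- `ψ_κ(θ) = log h_κ(θ)`. -/
def psiK (P : Measure Ω) (X Y : ℕ → Ω → A) (K : A → A → ℝ) (g : ℕ → ℝ) (κ : ℕ) (θ : ℝ) : ℝ :=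
  Real.log (h P X Y K g κ θ)

/-- `ψ(θ)`, the limit of `ψ_κ(θ) / κ` as `κ → ∞`. -/
def psi (P : Measure Ω) (X Y : ℕ → Ω → A) (K : A → A → ℝ) (g : ℕ → ℝ) (θ : ℝ) : ℝ :=
  limUnder atTop fun κ : ℕ => psiK P X Y K g κ θ / κ

/-- `z` attains the local alignment score of the first `n` letters of `x` and of `y`. -/
def IsOptimal (K : A → A → ℝ) (g : ℕ → ℝ) (x y : ℕ → A) (n : ℕ) (z : Alignment) : Prop :=
  localScore K g x y n n z = H K g x y n n

open Classical in
/-- The optimal local alignment `z_*` of the first `n` letters of `x` and of `y`: the smallest one,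
in the given ordering of all candidate alignments, that attains the local alignment score. (For
`n ≥ 1` it exists, since only finitely many alignments fit; the value for `n = 0` is arbitrary.) -/
def optimalAlignment (ord : LinearOrder Alignment) (K : A → A → ℝ) (g : ℕ → ℝ) (x y : ℕ → A)
    (n : ℕ) : Alignment :=
  if hz : ∃ z, IsOptimal K g x y n z ∧ ∀ z', IsOptimal K g x y n z' → ord.le z z' then hz.choose
  else Alignment.single

end LocalAlignment

end

/-! Let θ be the positive root of ψ and D = ψ'(θ). Two almost sure facts are played against each
other.

Upper bound. A union bound over starting positions, numbers of matches and lengths, combined with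
Markov's inequality, shows for all θ₁ > 0, τ > ψ(θ₁) and ε > 0 that eventually θ₁ S_z - τ|z| ≤ (2 +
ε) log n for every z within the first n letters (`highScore_le`, `ae_eventually_score_le`). The sum
over κ = |z| converges because h_κ(θ₁) = exp(κ(ψ(θ₁) + o(1))), and the N² starting positions produce
the constant 2.

Lower bound. For every c < 2/θ, eventually H ≥ c log n (`ae_eventually_le_H`).

For z = z_* together they give τ|z_*| ≥ (2θ₁/θ - 2 - ε') log n (`ae_eventually_le_card`). Put θ₁ = θ
+ δ and let τ be slightly above ψ(θ₁) ≈ Dδ. Small δ > 0 bounds |z_*| / log n below by nearly 2/(θD);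
small δ < 0 makes τ negative and gives the matching upper bound (`ae_tendsto_card`).

For the lower bound on H, ψ > 0 just above θ produces one event G_κ ≥ s whose probability is not
much below exp(-θs) (`exists_largeG`), and concatenation yields probability q ≥ exp(-θ'sk) for the
score ks, with θ' close to θ (`pow_le_largeG`). Cut both sequences into B blocks and call two blocks
related if their score is large. A plain second moment argument can fail, since the degrees of this
relation may be very uneven. It is therefore restricted to level sets of its degrees
(`exists_regular`) and then combined with its mirror image, which is possible because K is
symmetric: a doubled block matches another if both halves do. The mean becomes q'² and the second
moment of the degrees is at most of order q'³, up to polynomial factors, where q' is the probability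
of the restricted relation. Hence B slightly above 1/q suffices for the score 2ks
(`measureReal_no_related_le`, `H_lt_le`), which is the rate 2/θ.

The limit ψ exists by Fekete's lemma (`tendsto_psi`), it is convex (`convexOn_psi`), and D > 0
follows from convexity and the uniqueness of the root (`deriv_psi_pos`). -/

noncomputable section

namespace LocalAlignment

/-! ### Paths from the initial match to an excluded end point, and their scores. -/

section Paths

/-- A list of pairs that increases strictly in both coordinates. -/
abbrev Incr (l : List (ℕ × ℕ)) : Prop := l.Pairwise fun p q => p.1 < q.1 ∧ p.2 < q.2

/-- Translation of a pair of positions. -/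
def shiftPair (a b : ℕ) (p : ℕ × ℕ) : ℕ × ℕ := (a + p.1, b + p.2)

/-- The lists of `κ` pairs that start in `(0, 0)` and stay below `(m, n)`. -/
structure IsPath (κ m n : ℕ) (l : List (ℕ × ℕ)) : Prop where
  length_eq : l.length = κ
  head_eq : l.head? = some (0, 0)
  incr : Incr (l ++ [(m, n)])

/-- The score of a path, with a penalty for the letters between its last pair and `q`. -/
def pathScore {A : Type*} (K : A → A → ℝ) (g : ℕ → ℝ) (x y : ℕ → A) (q : ℕ × ℕ)
    (l : List (ℕ × ℕ)) : ℝ :=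
  (l.map fun p => K (x p.1) (y p.2)).sum - gapPenalty g (l ++ [q])

variable {A : Type*} {K : A → A → ℝ} {g : ℕ → ℝ} {x y : ℕ → A}

lemma gapPenalty_append_cons (g : ℕ → ℝ) (q : ℕ × ℕ) (b : List (ℕ × ℕ)) :
    ∀ a : List (ℕ × ℕ),
      gapPenalty g (a ++ q :: b) = gapPenalty g (a ++ [q]) + gapPenalty g (q :: b)
  | [] => by simp [gapPenalty]
  | [p] => by simp [gapPenalty]
  | p :: r :: a => by
    have := gapPenalty_append_cons g q b (r :: a)
    simp only [List.cons_append, gapPenalty] at this ⊢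
    rw [this]; ring

lemma gapPenalty_map_shiftPair (g : ℕ → ℝ) (a b : ℕ) :
    ∀ l : List (ℕ × ℕ), gapPenalty g (l.map (shiftPair a b)) = gapPenalty g l
  | [] => rfl
  | [_] => rfl
  | p :: q :: l => by
    have := gapPenalty_map_shiftPair g a b (q :: l)
    simp only [List.map_cons, gapPenalty] at this ⊢
    rw [this]
    simp [shiftPair, Nat.add_sub_add_left]

lemma gapPenalty_map_swap (g : ℕ → ℝ) :
    ∀ l : List (ℕ × ℕ), gapPenalty g (l.map Prod.swap) = gapPenalty g l
  | [] => rfl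
  | [_] => rfl
  | p :: q :: l => by
    have := gapPenalty_map_swap g (q :: l)
    simp only [List.map_cons, gapPenalty] at this ⊢
    rw [this]
    simp [add_comm]

lemma incr_map_shiftPair {a b : ℕ} {l : List (ℕ × ℕ)} :
    Incr (l.map (shiftPair a b)) ↔ Incr l := by
  simp [Incr, List.pairwise_map, shiftPair]

lemma exists_map_shiftPair {a b : ℕ} {l : List (ℕ × ℕ)} (h : ∀ p ∈ l, a ≤ p.1 ∧ b ≤ p.2) :
    ∃ l' : List (ℕ × ℕ), l = l'.map (shiftPair a b) := by
  refine ⟨l.map fun p => (p.1 - a, p.2 - b), ?_⟩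
  rw [List.map_map]
  conv_lhs => rw [← List.map_id l]
  refine List.map_congr_left fun p hp => ?_
  have := h p hp
  ext <;> simp [shiftPair] <;> omega

lemma length_le_of_incr (l : List (ℕ × ℕ)) :
    ∀ p : ℕ × ℕ, Incr (l ++ [p]) → l.length ≤ p.1 ∧ l.length ≤ p.2 := by
  induction l using List.reverseRecOn with
  | nil => simp
  | append_singleton l r ih =>
    intro p h
    have h1 := ih r (List.pairwise_append.1 h).1
    have h2 := (List.pairwise_append.1 h).2.2 r (by simp) p (by simp)
    simp only [List.length_append, List.length_singleton]
    omega

lemma IsPath.le_left {κ m n : ℕ} {l : List (ℕ × ℕ)} (h : IsPath κ m n l) : κ ≤ m :=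
  h.length_eq ▸ (length_le_of_incr l _ h.incr).1

lemma IsPath.le_right {κ m n : ℕ} {l : List (ℕ × ℕ)} (h : IsPath κ m n l) : κ ≤ n :=
  h.length_eq ▸ (length_le_of_incr l _ h.incr).2

lemma IsPath.eq_cons {κ m n : ℕ} {l : List (ℕ × ℕ)} (h : IsPath κ m n l) :
    ∃ t, l = (0, 0) :: t := by
  rcases l with _ | ⟨p, t⟩
  · simpa using h.head_eq
  · exact ⟨t, by simpa using h.head_eq⟩

lemma IsPath.lt {κ m n : ℕ} {l : List (ℕ × ℕ)} (h : IsPath κ m n l) {p : ℕ × ℕ} (hp : p ∈ l) :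
    p.1 < m ∧ p.2 < n :=
  (List.pairwise_append.1 h.incr).2.2 p hp (m, n) (by simp)

lemma isPath_diagonal {κ m n : ℕ} (hκ : 1 ≤ κ) (hm : κ ≤ m) (hn : κ ≤ n) :
    IsPath κ m n ((List.range κ).map fun i => (i, i)) := by
  refine ⟨by simp, ?_, ?_⟩
  · obtain ⟨k, rfl⟩ : ∃ k, κ = k + 1 := ⟨κ - 1, by omega⟩
    simp [List.range_succ_eq_map]
  · refine List.pairwise_append.2 ⟨?_, by simp, ?_⟩
    · rw [List.pairwise_map]
      simpa using List.pairwise_lt_range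
    · intro p hp q hq
      simp only [List.mem_map, List.mem_range, List.mem_singleton] at hp hq
      obtain ⟨i, hi, rfl⟩ := hp
      subst hq
      simp; omega

lemma pathScore_congr {x' y' : ℕ → A} {m n : ℕ} {κ : ℕ} {l : List (ℕ × ℕ)} (h : IsPath κ m n l)
    (hx : ∀ i < m, x i = x' i) (hy : ∀ j < n, y j = y' j) :
    pathScore K g x y (m, n) l = pathScore K g x' y' (m, n) l := by
  unfold pathScore
  congr 2
  apply List.map_congr_left
  intro p hp
  rw [hx _ (h.lt hp).1, hy _ (h.lt hp).2]

lemma IsPath.append {κ₁ κ₂ m₁ n₁ m₂ n₂ : ℕ} {l₁ l₂ : List (ℕ × ℕ)} (h₁ : IsPath κ₁ m₁ n₁ l₁)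
    (h₂ : IsPath κ₂ m₂ n₂ l₂) :
    IsPath (κ₁ + κ₂) (m₁ + m₂) (n₁ + n₂) (l₁ ++ l₂.map (shiftPair m₁ n₁)) := by
  refine ⟨by simp [h₁.length_eq, h₂.length_eq], ?_, ?_⟩
  · obtain ⟨t, rfl⟩ := h₁.eq_cons
    simp
  · have e : [(m₁ + m₂, n₁ + n₂)] = [(m₂, n₂)].map (shiftPair m₁ n₁) := by simp [shiftPair]
    rw [List.append_assoc, e, ← List.map_append]
    refine List.pairwise_append.2
      ⟨(List.pairwise_append.1 h₁.incr).1, incr_map_shiftPair.2 h₂.incr, ?_⟩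
    intro p hp q hq
    obtain ⟨r, -, rfl⟩ := List.mem_map.1 hq
    have := h₁.lt hp
    simp only [shiftPair]; omega

/-- The excluded end point of the first path becomes the first pair of the shifted second path, so
the trailing penalty of `l₁` is exactly the penalty of the gap at the junction. All sub- and
superadditivity rests on this. -/
lemma pathScore_append {κ₂ m₁ n₁ m₂ n₂ : ℕ} {l₁ l₂ : List (ℕ × ℕ)}
    (h₂ : IsPath κ₂ m₂ n₂ l₂) :
    pathScore K g x y (m₁ + m₂, n₁ + n₂) (l₁ ++ l₂.map (shiftPair m₁ n₁)) =
      pathScore K g x y (m₁, n₁) l₁ +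
        pathScore K g (fun i => x (m₁ + i)) (fun j => y (n₁ + j)) (m₂, n₂) l₂ := by
  obtain ⟨t, rfl⟩ := h₂.eq_cons
  have e : (l₁ ++ ((0, 0) :: t).map (shiftPair m₁ n₁)) ++ [(m₁ + m₂, n₁ + n₂)] =
      l₁ ++ (m₁, n₁) :: (t ++ [(m₂, n₂)]).map (shiftPair m₁ n₁) := by simp [shiftPair]
  have e2 : (m₁, n₁) :: (t ++ [(m₂, n₂)]).map (shiftPair m₁ n₁) =
      (((0, 0) :: t) ++ [(m₂, n₂)]).map (shiftPair m₁ n₁) := by simp [shiftPair]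
  have e3 : ((l₁ ++ ((0, 0) :: t).map (shiftPair m₁ n₁)).map fun p => K (x p.1) (y p.2)).sum =
      (l₁.map fun p => K (x p.1) (y p.2)).sum +
        (((0, 0) :: t).map fun p => K (x (m₁ + p.1)) (y (n₁ + p.2))).sum := by
    rw [List.map_append, List.sum_append, List.map_map]; rfl
  unfold pathScore
  rw [e, gapPenalty_append_cons, e2, gapPenalty_map_shiftPair, e3]
  ring

/-- The cut is made at the first pair after the initial `κ₁` ones; its coordinates are `(m₁, n₁)`.
-/
lemma IsPath.exists_split {κ₁ κ₂ m n : ℕ} {l : List (ℕ × ℕ)} (hκ₁ : 1 ≤ κ₁) (hκ₂ : 1 ≤ κ₂)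
    (h : IsPath (κ₁ + κ₂) m n l) :
    ∃ m₁ n₁ m₂ n₂ l₁ l₂, m = m₁ + m₂ ∧ n = n₁ + n₂ ∧ IsPath κ₁ m₁ n₁ l₁ ∧ IsPath κ₂ m₂ n₂ l₂ ∧
      l = l₁ ++ l₂.map (shiftPair m₁ n₁) := by
  have hlen := h.length_eq
  have hspl := List.take_append_drop κ₁ l
  have hl₁ : (l.take κ₁).length = κ₁ := by simp; omega
  have hl₂ : (l.drop κ₁).length = κ₂ := by simp; omega
  generalize l.take κ₁ = a at *
  rcases hq : l.drop κ₁ with _ | ⟨⟨m₁, n₁⟩, b⟩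
  · simp [hq] at hl₂; omega
  rw [hq] at hspl hl₂
  have hinc : Incr (a ++ ((m₁, n₁) :: (b ++ [(m, n)]))) := by
    have := h.incr
    rw [← hspl] at this
    simpa using this
  have hinc2 := (List.pairwise_append.1 hinc).2.1
  have hmem : ∀ p ∈ (m₁, n₁) :: (b ++ [(m, n)]), m₁ ≤ p.1 ∧ n₁ ≤ p.2 := by
    intro p hp
    rcases List.mem_cons.1 hp with rfl | hp
    · simp
    · have := (List.pairwise_cons.1 hinc2).1 p hp
      exact ⟨this.1.le, this.2.le⟩
  obtain ⟨l₂, hl₂'⟩ := exists_map_shiftPair (l := (m₁, n₁) :: b) (a := m₁) (b := n₁) (by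
    intro p hp; apply hmem; rw [← List.cons_append]; exact List.mem_append_left _ hp)
  have hmn := hmem (m, n) (by simp)
  refine ⟨m₁, n₁, m - m₁, n - n₁, a, l₂, by simp at hmn; omega, by simp at hmn; omega,
    ⟨hl₁, ?_, ?_⟩, ⟨?_, ?_, ?_⟩, ?_⟩
  · have := h.head_eq
    rw [← hspl] at this
    rcases a with _ | ⟨p, a⟩
    · simp at hl₁; omega
    · simpa using this
  · refine List.pairwise_append.2 ⟨(List.pairwise_append.1 hinc).1, by simp, ?_⟩
    intro p hp q hq
    exact (List.pairwise_append.1 hinc).2.2 p hp q (by simp at hq; simp [hq])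
  · rw [← hl₂, hl₂', List.length_map]
  · rcases l₂ with _ | ⟨⟨p1, p2⟩, l₂⟩
    · simp at hl₂'
    · simp [shiftPair] at hl₂'
      simp; omega
  · rw [← incr_map_shiftPair (a := m₁) (b := n₁), List.map_append, ← hl₂']
    have : shiftPair m₁ n₁ (m - m₁, n - n₁) = (m, n) := by
      simp [shiftPair] at hmn ⊢; omega
    simpa [this] using hinc2
  · rw [← hl₂', hspl]

lemma IsPath.swap {κ m n : ℕ} {l : List (ℕ × ℕ)} (h : IsPath κ m n l) :
    IsPath κ n m (l.map Prod.swap) := by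
  refine ⟨by simp [h.length_eq], ?_, ?_⟩
  · obtain ⟨t, rfl⟩ := h.eq_cons
    simp
  · have e : l.map Prod.swap ++ [(n, m)] = (l ++ [(m, n)]).map Prod.swap := by simp
    rw [e, Incr, List.pairwise_map]
    exact h.incr.imp fun h => ⟨h.2, h.1⟩

lemma pathScore_swap (hK : ∀ a b, K a b = K b a) {m n : ℕ} (l : List (ℕ × ℕ)) :
    pathScore K g y x (n, m) (l.map Prod.swap) = pathScore K g x y (m, n) l := by
  have e : l.map Prod.swap ++ [(n, m)] = (l ++ [(m, n)]).map Prod.swap := by simp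
  unfold pathScore
  rw [e, gapPenalty_map_swap, List.map_map]
  congr 2
  apply List.map_congr_left
  intro p _
  simp [hK]

/-- Increments of `g` decrease, so those after `b` are at most those after `0`. Concavity enters the
proof in this form only. -/
lemma subadditive_of_concave (hg0 : g 0 = 0)
    (hgconcave : ∀ k, g (k + 2) - g (k + 1) ≤ g (k + 1) - g k) (a b : ℕ) :
    g (a + b) ≤ g a + g b := by
  have hanti : Antitone fun k => g (k + 1) - g k := antitone_nat_of_succ_le hgconcave
  induction a with
  | zero => simp [hg0]
  | succ a ih =>
    have := hanti (show a ≤ a + b by omega)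
    simp only at this
    rw [show a + 1 + b = a + b + 1 by omega]
    linarith

/-- By subadditivity, merging all gaps in one sequence into a single gap cannot raise the penalty;
the argument of `g` on the left counts all skipped letters. -/
lemma le_gapPenalty (hgmono : Monotone g) (hsub : ∀ a b, g (a + b) ≤ g a + g b) (q : ℕ × ℕ) :
    ∀ (l : List (ℕ × ℕ)) (p : ℕ × ℕ), Incr (p :: (l ++ [q])) →
      g (q.1 - p.1 - (l.length + 1)) + g (q.2 - p.2 - (l.length + 1)) ≤
        gapPenalty g (p :: (l ++ [q]))
  | [], p, _ => by simp [gapPenalty]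
  | r :: l, p, h => by
    have h1 := le_gapPenalty hgmono hsub q l r (List.pairwise_cons.1 h).2
    have h2 := (List.pairwise_cons.1 h).1 r (by simp)
    have h3 : ∀ i j k : ℕ, j < k → g (i - j - (l.length + 1 + 1)) ≤
        g (k - j - 1) + g (i - k - (l.length + 1)) := fun i j k hjk =>
      (hgmono (by omega)).trans (hsub _ _)
    have h4 := h3 q.1 p.1 r.1 h2.1
    have h5 := h3 q.2 p.2 r.2 h2.2
    simp only [List.cons_append, gapPenalty, List.length_cons] at h1 ⊢
    linarith

lemma pathScore_le (hgmono : Monotone g) (hsub : ∀ a b, g (a + b) ≤ g a + g b) {M : ℝ}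
    (hM : ∀ a b, K a b ≤ M) {κ m n : ℕ} {l : List (ℕ × ℕ)} (h : IsPath κ m n l) :
    pathScore K g x y (m, n) l ≤ κ * M - g (m - κ) - g (n - κ) := by
  have h1 : (l.map fun p => K (x p.1) (y p.2)).sum ≤ κ * M := by
    have := List.sum_le_card_nsmul (l.map fun p => K (x p.1) (y p.2)) M (by
      intro r hr
      obtain ⟨p, -, rfl⟩ := List.mem_map.1 hr
      exact hM _ _)
    simpa [h.length_eq] using this
  obtain ⟨t, rfl⟩ := h.eq_cons
  have h2 := le_gapPenalty hgmono hsub (m, n) t (0, 0) h.incr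
  have h3 := h.length_eq
  simp only [List.length_cons] at h3
  rw [h3] at h2
  simp only [Nat.sub_zero] at h2
  unfold pathScore
  rw [List.cons_append]
  linarith

lemma pathScore_diagonal_ge {M : ℝ} (hM : ∀ a b, -M ≤ K a b) (hg0 : g 0 = 0) (κ : ℕ) :
    -(κ * M) ≤ pathScore K g x y (κ, κ) ((List.range κ).map fun i => (i, i)) := by
  have h1 : gapPenalty g ((List.range κ).map (fun i => (i, i)) ++ [(κ, κ)]) = 0 := by
    have e : (List.range κ).map (fun i => (i, i)) ++ [(κ, κ)] =
        (List.range (κ + 1)).map (fun i => (i, i)) := by simp [List.range_succ]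
    rw [e]
    clear e
    induction κ with
    | zero => simp [gapPenalty]
    | succ k ih =>
      rw [List.range_succ_eq_map, List.map_cons, List.map_map]
      have e : List.map ((fun i => (i, i)) ∘ Nat.succ) (List.range (k + 1)) =
          ((List.range (k + 1)).map (fun i => (i, i))).map (shiftPair 1 1) := by
        rw [List.map_map]
        apply List.map_congr_left
        intro a _
        simp [shiftPair, Nat.succ_eq_add_one, add_comm]
      have e2 := gapPenalty_map_shiftPair g 1 1 ((List.range (k + 1)).map (fun i => (i, i)))
      rw [e]
      rw [ih] at e2
      rw [List.range_succ_eq_map, List.map_cons, List.map_cons] at e2 ⊢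
      simp only [gapPenalty, e2]
      simp [shiftPair, hg0]
  have h2 := List.card_nsmul_le_sum
    (((List.range κ).map fun i => (i, i)).map fun p : ℕ × ℕ => K (x p.1) (y p.2)) (-M) (by
      intro r hr
      obtain ⟨p, -, rfl⟩ := List.mem_map.1 hr
      exact hM _ _)
  unfold pathScore
  rw [h1]
  simp only [List.length_map, List.length_range, nsmul_eq_mul] at h2
  linarith

end Paths

/-! ### The scores of alignments and `G` in terms of paths. -/

section Scores

/-- An increasing list is determined by its set of entries, and there are finitely many subsets of a
box. -/
lemma finite_incr (m n : ℕ) :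
    {l : List (ℕ × ℕ) | Incr l ∧ ∀ p ∈ l, p.1 < m ∧ p.2 < n}.Finite := by
  have hnodup : ∀ l : List (ℕ × ℕ), Incr l → l.Nodup := fun l h =>
    h.imp fun {p q} h e => by simp [e] at h
  refine Set.Finite.of_injOn (f := List.toFinset)
    (t := ((Finset.range m ×ˢ Finset.range n).powerset : Set (Finset (ℕ × ℕ)))) ?_ ?_
    (Finset.finite_toSet _)
  · rintro l ⟨-, hl⟩
    simp only [Finset.coe_powerset, Set.mem_preimage, Set.mem_powerset_iff]
    intro p hp
    simpa using hl p (by simpa using hp)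
  · rintro l ⟨hl, -⟩ l' ⟨hl', -⟩ h
    exact (List.perm_of_nodup_nodup_toFinset_eq (hnodup l hl) (hnodup l' hl') h).eq_of_pairwise
      (fun a b _ _ h1 h2 => absurd h1.1 h2.1.asymm) hl hl'

lemma Alignment.Fits.lt {z : Alignment} {m n : ℕ} (h : z.Fits m n) {p : ℕ × ℕ}
    (hp : p ∈ z.pairs) : p.1 < m ∧ p.2 < n := by
  have h1 := z.increasing
  rw [← List.dropLast_append_getLast z.nonempty] at h1 hp
  have h2 : (z.pairs.getLast z.nonempty).1 < m ∧ (z.pairs.getLast z.nonempty).2 < n := h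
  rcases List.mem_append.1 hp with hp | hp
  · have := (List.pairwise_append.1 h1).2.2 p hp _ (List.mem_singleton_self _)
    omega
  · rw [List.mem_singleton.1 hp]; exact h2

lemma finite_fits (m n : ℕ) : {z : Alignment | z.Fits m n}.Finite := by
  refine Set.Finite.of_injOn (f := Alignment.pairs) ?_ ?_ (finite_incr m n)
  · exact fun z hz => ⟨z.increasing, fun p hp => Alignment.Fits.lt hz hp⟩
  · rintro ⟨l, _, _⟩ - ⟨l', _, _⟩ - h
    simpa using h

variable {A : Type*} {K : A → A → ℝ} {g : ℕ → ℝ} {x y : ℕ → A}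

/-- The score of an alignment without regard to where it fits. -/
def rawScore (K : A → A → ℝ) (g : ℕ → ℝ) (x y : ℕ → A) (z : Alignment) : ℝ :=
  (z.pairs.map fun p => K (x p.1) (y p.2)).sum - gapPenalty g z.pairs

lemma localScore_of_fits {m n : ℕ} {z : Alignment} (h : z.Fits m n) :
    localScore K g x y m n z = (rawScore K g x y z : EReal) := by
  simp [localScore, h, rawScore]

lemma localScore_of_not_fits {m n : ℕ} {z : Alignment} (h : ¬ z.Fits m n) :
    localScore K g x y m n z = ⊥ := by
  simp [localScore, h]

lemma finite_isPath (κ m n : ℕ) : {l | IsPath κ m n l}.Finite :=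
  (finite_incr m n).subset fun _ h => ⟨(List.pairwise_append.1 h.incr).1, fun _ hp => h.lt hp⟩

lemma isPath_of_fits {κ m n : ℕ} {z : Alignment} (h0 : (0, 0) ∈ z.pairs) (hc : z.card = κ)
    (hf : z.Fits m n) : IsPath κ m n z.pairs := by
  refine ⟨hc, ?_, List.pairwise_append.2 ⟨z.increasing, by simp, ?_⟩⟩
  · obtain ⟨l, hne, hi⟩ := z
    rcases l with _ | ⟨p, t⟩
    · simp at hne
    · rcases List.mem_cons.1 h0 with h0 | h0
      · simp [h0]
      · have := (List.pairwise_cons.1 hi).1 _ h0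
        simp at this
  · intro p hp q hq
    rw [List.mem_singleton.1 hq]
    exact hf.lt hp

lemma gapPenalty_append_singleton (g : ℕ → ℝ) {l : List (ℕ × ℕ)} (hl : l ≠ []) (q : ℕ × ℕ) :
    gapPenalty g (l ++ [q]) = gapPenalty g l +
      (g (q.1 - (l.getLast hl).1 - 1) + g (q.2 - (l.getLast hl).2 - 1)) := by
  have h1 := gapPenalty_append_cons g (l.getLast hl) [q] l.dropLast
  have h2 := List.dropLast_append_getLast hl
  have h3 : l.dropLast ++ l.getLast hl :: [q] = l ++ [q] := by
    conv_rhs => rw [← h2]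
    simp
  rw [h3, h2] at h1
  rw [h1]
  simp [gapPenalty]

/-- The initial penalties are `g 0`, and the final ones are those of a gap before the virtual pair
`(m, n)`. -/
lemma globalScore_of_isPath (hg0 : g 0 = 0) {κ m n : ℕ} {z : Alignment}
    (h : IsPath κ m n z.pairs) :
    globalScore K g x y m n z = (pathScore K g x y (m, n) z.pairs : EReal) := by
  have hf : z.Fits m n := h.lt (List.getLast_mem z.nonempty)
  have hfirst : z.first = (0, 0) := by
    have := h.head_eq
    rw [List.head?_eq_some_head z.nonempty] at this
    simpa [Alignment.first] using this
  rw [globalScore, localScore_of_fits hf, ← EReal.coe_sub, pathScore,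
    gapPenalty_append_singleton g z.nonempty, rawScore, hfirst]
  congr 1
  simp only [hg0, Alignment.last, Nat.sub_right_comm _ 1]
  ring

lemma G_spec (hg0 : g 0 = 0) {κ m n : ℕ} (hκ : 1 ≤ κ) (hm : κ ≤ m) (hn : κ ≤ n) :
    ∃ l, IsPath κ m n l ∧ G K g κ x y m n = (pathScore K g x y (m, n) l : EReal) ∧
      ∀ l', IsPath κ m n l' → pathScore K g x y (m, n) l' ≤ pathScore K g x y (m, n) l := by
  obtain ⟨l, hl, hmax⟩ := Set.exists_max_image {l | IsPath κ m n l}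
    (pathScore K g x y (m, n)) (finite_isPath κ m n) ⟨_, isPath_diagonal hκ hm hn⟩
  refine ⟨l, hl, le_antisymm ?_ ?_, hmax⟩
  · refine iSup₂_le fun z hz => ?_
    by_cases hf : z.Fits m n
    · have hp := isPath_of_fits hz.1 hz.2 hf
      rw [globalScore_of_isPath hg0 hp]
      exact EReal.coe_le_coe_iff.2 (hmax _ hp)
    · rw [globalScore, localScore_of_not_fits hf, EReal.bot_sub]
      exact bot_le
  · obtain ⟨t, rfl⟩ := hl.eq_cons
    let z : Alignment := ⟨(0, 0) :: t, by simp, (List.pairwise_append.1 hl.incr).1⟩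
    rw [← globalScore_of_isPath (z := z) hg0 hl]
    exact le_iSup₂_of_le z ⟨by simp [z], hl.length_eq⟩ le_rfl

lemma pathScore_le_G (hg0 : g 0 = 0) {κ m n : ℕ} (hκ : 1 ≤ κ) {l : List (ℕ × ℕ)}
    (hl : IsPath κ m n l) : pathScore K g x y (m, n) l ≤ (G K g κ x y m n).toReal := by
  obtain ⟨l', -, h1, h2⟩ := G_spec (K := K) (x := x) (y := y) hg0 hκ hl.le_left hl.le_right
  rw [h1, EReal.toReal_coe]
  exact h2 l hl

lemma exists_isPath_eq_G (hg0 : g 0 = 0) {κ m n : ℕ} (hκ : 1 ≤ κ) (hm : κ ≤ m) (hn : κ ≤ n) :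
    ∃ l, IsPath κ m n l ∧ (G K g κ x y m n).toReal = pathScore K g x y (m, n) l := by
  obtain ⟨l', h, h1, -⟩ := G_spec (K := K) (x := x) (y := y) hg0 hκ hm hn
  exact ⟨l', h, by rw [h1, EReal.toReal_coe]⟩

lemma G_congr (hg0 : g 0 = 0) {κ m n : ℕ} (hκ : 1 ≤ κ) (hm : κ ≤ m) (hn : κ ≤ n)
    {x' y' : ℕ → A} (hx : ∀ i < m, x i = x' i) (hy : ∀ j < n, y j = y' j) :
    (G K g κ x y m n).toReal = (G K g κ x' y' m n).toReal := by
  obtain ⟨l, hl, h1⟩ := exists_isPath_eq_G (K := K) (x := x) (y := y) hg0 hκ hm hn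
  obtain ⟨l', hl', h1'⟩ := exists_isPath_eq_G (K := K) (x := x') (y := y') hg0 hκ hm hn
  apply le_antisymm
  · rw [h1, pathScore_congr hl hx hy]
    exact pathScore_le_G hg0 hκ hl
  · rw [h1', ← pathScore_congr hl' hx hy]
    exact pathScore_le_G hg0 hκ hl'

lemma G_add_le (hg0 : g 0 = 0) {κ₁ κ₂ m₁ n₁ m₂ n₂ : ℕ} (hκ₁ : 1 ≤ κ₁) (hκ₂ : 1 ≤ κ₂)
    (hm₁ : κ₁ ≤ m₁) (hn₁ : κ₁ ≤ n₁) (hm₂ : κ₂ ≤ m₂) (hn₂ : κ₂ ≤ n₂) :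
    (G K g κ₁ x y m₁ n₁).toReal +
        (G K g κ₂ (fun i => x (m₁ + i)) (fun j => y (n₁ + j)) m₂ n₂).toReal ≤
      (G K g (κ₁ + κ₂) x y (m₁ + m₂) (n₁ + n₂)).toReal := by
  obtain ⟨l₁, hl₁, e₁⟩ := exists_isPath_eq_G (K := K) (x := x) (y := y) hg0 hκ₁ hm₁ hn₁
  obtain ⟨l₂, hl₂, e₂⟩ := exists_isPath_eq_G (K := K) (x := fun i => x (m₁ + i))
    (y := fun j => y (n₁ + j)) hg0 hκ₂ hm₂ hn₂
  rw [e₁, e₂, ← pathScore_append hl₂]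
  exact pathScore_le_G hg0 (by omega) (hl₁.append hl₂)

/-- The cut depends on the letters, so expectations have to be bounded by a sum over all cuts. -/
lemma exists_G_le_add (hg0 : g 0 = 0) {κ₁ κ₂ m n : ℕ} (hκ₁ : 1 ≤ κ₁) (hκ₂ : 1 ≤ κ₂)
    (hm : κ₁ + κ₂ ≤ m) (hn : κ₁ + κ₂ ≤ n) :
    ∃ m₁ n₁ m₂ n₂, m = m₁ + m₂ ∧ n = n₁ + n₂ ∧ κ₁ ≤ m₁ ∧ κ₁ ≤ n₁ ∧ κ₂ ≤ m₂ ∧ κ₂ ≤ n₂ ∧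
      (G K g (κ₁ + κ₂) x y m n).toReal ≤ (G K g κ₁ x y m₁ n₁).toReal +
        (G K g κ₂ (fun i => x (m₁ + i)) (fun j => y (n₁ + j)) m₂ n₂).toReal := by
  obtain ⟨l, hl, e⟩ := exists_isPath_eq_G (K := K) (x := x) (y := y) hg0
    (by omega : 1 ≤ κ₁ + κ₂) hm hn
  obtain ⟨m₁, n₁, m₂, n₂, l₁, l₂, rfl, rfl, h₁, h₂, rfl⟩ := hl.exists_split hκ₁ hκ₂
  refine ⟨m₁, n₁, m₂, n₂, rfl, rfl, h₁.le_left, h₁.le_right, h₂.le_left, h₂.le_right, ?_⟩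
  rw [e, pathScore_append h₂]
  exact add_le_add (pathScore_le_G hg0 hκ₁ h₁) (pathScore_le_G hg0 hκ₂ h₂)

lemma G_le (hg0 : g 0 = 0) (hgmono : Monotone g) (hsub : ∀ a b, g (a + b) ≤ g a + g b) {M : ℝ}
    (hM : ∀ a b, K a b ≤ M) {κ m n : ℕ} (hκ : 1 ≤ κ) (hm : κ ≤ m) (hn : κ ≤ n) :
    (G K g κ x y m n).toReal ≤ κ * M - g (m - κ) - g (n - κ) := by
  obtain ⟨l, hl, e⟩ := exists_isPath_eq_G (K := K) (x := x) (y := y) hg0 hκ hm hn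
  rw [e]
  exact pathScore_le hgmono hsub hM hl

lemma G_self_ge (hg0 : g 0 = 0) {M : ℝ} (hM : ∀ a b, -M ≤ K a b) {κ : ℕ} (hκ : 1 ≤ κ) :
    -(κ * M) ≤ (G K g κ x y κ κ).toReal :=
  (pathScore_diagonal_ge hM hg0 κ).trans
    (pathScore_le_G hg0 hκ (isPath_diagonal hκ le_rfl le_rfl))

lemma G_swap (hg0 : g 0 = 0) (hK : ∀ a b, K a b = K b a) {κ m n : ℕ} (hκ : 1 ≤ κ) (hm : κ ≤ m)
    (hn : κ ≤ n) : (G K g κ y x n m).toReal = (G K g κ x y m n).toReal := by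
  obtain ⟨l, hl, e⟩ := exists_isPath_eq_G (K := K) (x := x) (y := y) hg0 hκ hm hn
  obtain ⟨l', hl', e'⟩ := exists_isPath_eq_G (K := K) (x := y) (y := x) hg0 hκ hn hm
  apply le_antisymm
  · rw [e', ← pathScore_swap hK]
    exact pathScore_le_G hg0 hκ hl'.swap
  · rw [e, ← pathScore_swap hK]
    exact pathScore_le_G hg0 hκ hl.swap

/-- Reading both sequences from the first match of `z`, and stopping directly after its last match,
removes all end penalties because `g 0 = 0`. -/
lemma rawScore_le_G (hg0 : g 0 = 0) {N : ℕ} {z : Alignment} (h : z.Fits N N) :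
    ∃ i j m n, i + m ≤ N ∧ j + n ≤ N ∧ 1 ≤ z.card ∧ z.card ≤ m ∧ z.card ≤ n ∧
      rawScore K g x y z ≤
        (G K g z.card (fun t => x (i + t)) (fun t => y (j + t)) m n).toReal := by
  have hbox := fun p hp => h.lt (p := p) hp
  obtain ⟨l, hne, hi⟩ := z
  have hlast := List.getLast_mem hne
  have hgap := gapPenalty_append_singleton g hne
    ((l.getLast hne).1 + 1, (l.getLast hne).2 + 1)
  simp only [Nat.add_sub_cancel_left, Nat.sub_self, hg0, add_zero] at hgap
  have hinc : Incr (l ++ [((l.getLast hne).1 + 1, (l.getLast hne).2 + 1)]) := by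
    refine List.pairwise_append.2 ⟨hi, by simp, ?_⟩
    intro p hp q hq
    rw [List.mem_singleton.1 hq]
    exact Alignment.Fits.lt (z := ⟨l, hne, hi⟩) (by simp [Alignment.Fits, Alignment.last]) hp
  have hlt := hbox _ hlast
  generalize l.getLast hne = e at hgap hinc hlt
  obtain ⟨⟨i, j⟩, t, rfl⟩ := List.exists_cons_of_ne_nil hne
  have hle : ∀ p ∈ (i, j) :: t ++ [(e.1 + 1, e.2 + 1)], i ≤ p.1 ∧ j ≤ p.2 := by
    intro p hp
    rcases List.mem_cons.1 hp with rfl | hp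
    · simp
    · have := (List.pairwise_cons.1 hinc).1 p hp
      exact ⟨this.1.le, this.2.le⟩
  obtain ⟨l', hl'⟩ := exists_map_shiftPair (l := (i, j) :: t) (a := i) (b := j)
    fun p hp => hle p (List.mem_append_left _ hp)
  have he := hle (e.1 + 1, e.2 + 1) (by simp)
  simp only at he
  have hsh : [(e.1 + 1, e.2 + 1)] = [(e.1 + 1 - i, e.2 + 1 - j)].map (shiftPair i j) := by
    simp [shiftPair]; omega
  rw [hl', hsh, ← List.map_append, gapPenalty_map_shiftPair, gapPenalty_map_shiftPair] at hgap
  rw [hl', hsh, ← List.map_append, incr_map_shiftPair] at hinc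
  have hpath : IsPath ((i, j) :: t).length (e.1 + 1 - i) (e.2 + 1 - j) l' := by
    refine ⟨by rw [hl', List.length_map], ?_, hinc⟩
    rcases l' with _ | ⟨⟨p1, p2⟩, l'⟩
    · simp at hl'
    · simp [shiftPair] at hl'
      simp; omega
  refine ⟨i, j, e.1 + 1 - i, e.2 + 1 - j, by omega, by omega, by simp [Alignment.card],
    hpath.le_left, hpath.le_right, ?_⟩
  have hscore : rawScore K g x y ⟨(i, j) :: t, hne, hi⟩ =
      pathScore K g (fun t => x (i + t)) (fun t => y (j + t)) (e.1 + 1 - i, e.2 + 1 - j) l' := by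
    simp only [rawScore, pathScore]
    rw [hl', hgap, gapPenalty_map_shiftPair, List.map_map]
    rfl
  rw [hscore]
  exact pathScore_le_G hg0 (by simp [Alignment.card]) hpath

lemma gapPenalty_le_append (hg : ∀ k, 0 ≤ g k) {l : List (ℕ × ℕ)} (hl : l ≠ []) (q : ℕ × ℕ) :
    gapPenalty g l ≤ gapPenalty g (l ++ [q]) := by
  rw [gapPenalty_append_singleton g hl]
  linarith [hg (q.1 - (l.getLast hl).1 - 1), hg (q.2 - (l.getLast hl).2 - 1)]

lemma G_le_H (hg0 : g 0 = 0) (hg : ∀ k, 0 ≤ g k) {κ i j m n N : ℕ} (hκ : 1 ≤ κ) (hm : κ ≤ m)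
    (hn : κ ≤ n) (hi : i + m ≤ N) (hj : j + n ≤ N) :
    ((G K g κ (fun t => x (i + t)) (fun t => y (j + t)) m n).toReal : EReal) ≤
      H K g x y N N := by
  obtain ⟨l, hl, e⟩ := exists_isPath_eq_G (K := K) (x := fun t => x (i + t))
    (y := fun t => y (j + t)) hg0 hκ hm hn
  have hne : l ≠ [] := by
    obtain ⟨t, rfl⟩ := hl.eq_cons
    simp
  let z : Alignment := ⟨l.map (shiftPair i j), by simpa using hne,
    incr_map_shiftPair.2 (List.pairwise_append.1 hl.incr).1⟩
  have hf : z.Fits N N := by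
    have := List.getLast_mem z.nonempty
    obtain ⟨p, hp, hp'⟩ := List.mem_map.1 this
    have h := hl.lt hp
    simp only [Alignment.Fits, Alignment.last, ← hp', shiftPair]
    omega
  refine le_trans ?_ (le_iSup _ z)
  rw [localScore_of_fits hf, e, EReal.coe_le_coe_iff]
  simp only [rawScore, pathScore, z, gapPenalty_map_shiftPair, List.map_map]
  exact sub_le_sub le_rfl (gapPenalty_le_append hg hne _)

/-- Since `Alignment.single` fits, the optimal score is not `⊥`. Hence optimal alignments fit, there
are finitely many of them, and the default branch of the definition is not taken. -/
lemma optimalAlignment_spec (ord : LinearOrder Alignment) {N : ℕ} (hN : 1 ≤ N) :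
    (optimalAlignment ord K g x y N).Fits N N ∧
      (rawScore K g x y (optimalAlignment ord K g x y N) : EReal) = H K g x y N N := by
  have hopt : ∀ z, IsOptimal K g x y N z → z.Fits N N := by
    intro z hz
    by_contra hf
    rw [IsOptimal, localScore_of_not_fits hf] at hz
    have h1 : (Alignment.single).Fits N N := by
      simp [Alignment.Fits, Alignment.last, Alignment.single]; omega
    have h2 := le_iSup (localScore K g x y N N) Alignment.single
    rw [localScore_of_fits h1] at h2
    change _ ≤ H K g x y N N at h2
    rw [← hz, le_bot_iff] at h2
    exact EReal.coe_ne_bot _ h2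
  have hex : ∃ z, IsOptimal K g x y N z := by
    have h1 : (Alignment.single).Fits N N := by
      simp [Alignment.Fits, Alignment.last, Alignment.single]; omega
    obtain ⟨z, hz, hmax⟩ := Set.exists_max_image {z : Alignment | z.Fits N N}
      (rawScore K g x y) (finite_fits N N) ⟨_, h1⟩
    refine ⟨z, le_antisymm (le_iSup (localScore K g x y N N) z) (iSup_le fun z' => ?_)⟩
    by_cases hf : z'.Fits N N
    · rw [localScore_of_fits hf, localScore_of_fits hz]
      exact EReal.coe_le_coe_iff.2 (hmax _ hf)
    · rw [localScore_of_not_fits hf]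
      exact bot_le
  have hmin : ∃ z, IsOptimal K g x y N z ∧ ∀ z', IsOptimal K g x y N z' → ord.le z z' :=
    @Set.exists_min_image _ _ ord {z | IsOptimal K g x y N z} id
      ((finite_fits N N).subset hopt) hex
  have h : IsOptimal K g x y N (optimalAlignment ord K g x y N) := by
    rw [optimalAlignment, dif_pos hmin]
    exact hmin.choose_spec.1
  exact ⟨hopt _ h, by rw [← localScore_of_fits (hopt _ h)]; exact h⟩

end Scores

/-! ### Expectations of functions of finitely many letters as weighted sums over words. -/

section Words

/-- The weight of a word under independent letters of weight `w`. -/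
def wordWeight {A : Type*} (w : A → ℝ) {ι : Type*} [Fintype ι] (t : ι → A) : ℝ := ∏ i, w (t i)

variable {A : Type*} {w : A → ℝ} {ι ι' : Type*} [Fintype ι] [Fintype ι']

lemma wordWeight_nonneg (hw : ∀ a, 0 ≤ w a) (t : ι → A) : 0 ≤ wordWeight w t :=
  Finset.prod_nonneg fun _ _ => hw _

lemma wordWeight_sumElim (s : ι → A) (t : ι' → A) :
    wordWeight w (Sum.elim s t) = wordWeight w s * wordWeight w t := by
  simp [wordWeight, Fintype.prod_sum_type]

variable [Fintype A]

lemma sum_wordWeight [DecidableEq ι] (hw : ∑ a, w a = 1) : ∑ t : ι → A, wordWeight w t = 1 := by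
  unfold wordWeight
  rw [← Fintype.prod_sum (fun _ a => w a)]
  simp [hw]

lemma sum_sumArrow [DecidableEq ι] [DecidableEq ι'] (φ : (ι ⊕ ι' → A) → ℝ) :
    ∑ t, wordWeight w t * φ t =
      ∑ s : ι → A, ∑ t : ι' → A, wordWeight w s * wordWeight w t * φ (Sum.elim s t) := by
  rw [← Fintype.sum_prod_type']
  refine Fintype.sum_equiv (Equiv.sumArrowEquivProdArrow ι ι' A) _ _ fun t => ?_
  have : t = Sum.elim (t ∘ Sum.inl) (t ∘ Sum.inr) := (Sum.elim_comp_inl_inr t).symm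
  conv_lhs => rw [this, wordWeight_sumElim]
  rfl

variable [MeasurableSpace A] [MeasurableSingletonClass A] {Ω : Type*} [MeasurableSpace Ω]
  {P : Measure Ω} [IsProbabilityMeasure P] {μ : Measure A} {κ : Type*} {W : κ → Ω → A}

lemma measurable_word (hW : ∀ k, Measurable (W k)) (e : ι → κ) {β : Type*} [MeasurableSpace β]
    (φ : (ι → A) → β) : Measurable fun ω => φ fun i => W (e i) ω :=
  (measurable_of_countable φ).comp (measurable_pi_lambda _ fun i => hW (e i))

lemma integrable_word (hW : ∀ k, Measurable (W k)) (e : ι → κ) (φ : (ι → A) → ℝ) :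
    Integrable (fun ω => φ fun i => W (e i) ω) P := by
  have h1 : Measurable fun ω => fun i => W (e i) ω := measurable_pi_lambda _ fun i => hW (e i)
  have : IsProbabilityMeasure (P.map fun ω => fun i => W (e i) ω) :=
    Measure.isProbabilityMeasure_map h1.aemeasurable
  exact (Integrable.of_finite (f := φ)).comp_measurable h1

lemma integral_word [DecidableEq ι] (hW : ∀ k, Measurable (W k)) (hμ : ∀ k, P.map (W k) = μ)
    (hind : iIndepFun W P) {e : ι → κ} (he : e.Injective) (φ : (ι → A) → ℝ) :
    ∫ ω, φ (fun i => W (e i) ω) ∂P = ∑ t, wordWeight (fun a => μ.real {a}) t * φ t := by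
  have h1 : Measurable fun ω => fun i => W (e i) ω := measurable_pi_lambda _ fun i => hW (e i)
  have h2 := (iIndepFun_iff_map_fun_eq_pi_map
    (fun i => (hW (e i)).aemeasurable)).1 (hind.precomp he)
  simp only [hμ] at h2
  have : IsProbabilityMeasure (P.map fun ω => fun i => W (e i) ω) :=
    Measure.isProbabilityMeasure_map h1.aemeasurable
  have h3 := integral_map (μ := P) h1.aemeasurable (f := φ)
    (measurable_of_countable φ).aestronglyMeasurable
  rw [← h3, integral_fintype Integrable.of_finite]
  refine Finset.sum_congr rfl fun t _ => ?_
  rw [smul_eq_mul]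
  congr 1
  -- Without an index no letter is at hand to show that `μ` is a probability measure; the empty word
  -- is treated directly.
  rcases isEmpty_or_nonempty ι with hι | ⟨⟨i⟩⟩
  · have : ({t} : Set (ι → A)) = Set.univ := by ext s; simp [Subsingleton.elim s t]
    rw [this, probReal_univ]
    simp [wordWeight]
  · have hμP : IsProbabilityMeasure μ := by
      rw [← hμ (e i)]; exact Measure.isProbabilityMeasure_map (hW _).aemeasurable
    have h4 : P.map (fun ω => fun i => W (e i) ω) = Measure.pi fun _ => μ := h2
    rw [h4, Measure.real, Measure.pi_singleton, ENNReal.toReal_prod]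
    rfl

lemma integral_word_two [DecidableEq ι] [DecidableEq ι'] (hW : ∀ k, Measurable (W k))
    (hμ : ∀ k, P.map (W k) = μ) (hind : iIndepFun W P) {e : ι → κ} {e' : ι' → κ}
    (he : (Sum.elim e e').Injective) (φ : (ι → A) → (ι' → A) → ℝ) :
    ∫ ω, φ (fun i => W (e i) ω) (fun i => W (e' i) ω) ∂P =
      ∑ s, ∑ t, wordWeight (fun a => μ.real {a}) s * wordWeight (fun a => μ.real {a}) t *
        φ s t := by
  have h := integral_word hW hμ hind he fun u => φ (u ∘ Sum.inl) (u ∘ Sum.inr)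
  rw [sum_sumArrow] at h
  exact h

lemma integral_word_mul [DecidableEq ι] [DecidableEq ι'] (hW : ∀ k, Measurable (W k))
    (hμ : ∀ k, P.map (W k) = μ) (hind : iIndepFun W P) {e : ι → κ} {e' : ι' → κ}
    (he : (Sum.elim e e').Injective) (φ : (ι → A) → ℝ) (φ' : (ι' → A) → ℝ) :
    ∫ ω, φ (fun i => W (e i) ω) * φ' (fun i => W (e' i) ω) ∂P =
      (∫ ω, φ (fun i => W (e i) ω) ∂P) * ∫ ω, φ' (fun i => W (e' i) ω) ∂P := by
  rw [integral_word_two hW hμ hind he (fun s t => φ s * φ' t),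
    integral_word hW hμ hind (e := e) (fun a b h => Sum.inl_injective (he h)),
    integral_word hW hμ hind (e := e') (fun a b h => Sum.inr_injective (he h)),
    Finset.sum_mul_sum]
  exact Finset.sum_congr rfl fun _ _ => Finset.sum_congr rfl fun _ _ => by ring

end Words

/-! ### Shift invariance and independence for functions of initial segments. -/

section Sequences

variable {A : Type*}

/-- `φ` depends on the first `m` letters of `x` and the first `n` letters of `y` only. -/
def IsLocal {β : Type*} (m n : ℕ) (φ : (ℕ → A) → (ℕ → A) → β) : Prop :=
  ∀ ⦃x x' y y' : ℕ → A⦄, (∀ i < m, x i = x' i) → (∀ j < n, y j = y' j) → φ x y = φ x' y'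

/-- The letters of `x` and `y` are independent with law `μ`. -/
structure IsLetterModel {Ω : Type*} [MeasurableSpace Ω] [MeasurableSpace A] (P : Measure Ω)
    (μ : Measure A) (X Y : ℕ → Ω → A) : Prop where
  measurable_left : ∀ i, Measurable (X i)
  measurable_right : ∀ j, Measurable (Y j)
  law_left : ∀ i, P.map (X i) = μ
  law_right : ∀ j, P.map (Y j) = μ
  indep : iIndepFun (Sum.elim X Y) P

/-- The sequence that continues a word by a constant. -/
def extendWord (a : A) {m : ℕ} (t : Fin m → A) (i : ℕ) : A :=
  if h : i < m then t ⟨i, h⟩ else a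

lemma extendWord_of_lt (a : A) {m : ℕ} (t : Fin m → A) {i : ℕ} (h : i < m) :
    extendWord a t i = t ⟨i, h⟩ := dif_pos h

/-- The positions of the words of length `m` and `n` that start in `i` and `j`. -/
def positions (i j m n : ℕ) : Fin m ⊕ Fin n → ℕ ⊕ ℕ :=
  Sum.map (fun t => i + t) (fun t => j + t)

lemma positions_injective (i j m n : ℕ) : (positions i j m n).Injective :=
  Function.Injective.sumMap (fun a b h => Fin.ext (by simpa using h))
    (fun a b h => Fin.ext (by simpa using h))

/-- A local function as a function of words. -/
def onWords {β : Type*} (a : A) (m n : ℕ) (φ : (ℕ → A) → (ℕ → A) → β) (t : Fin m ⊕ Fin n → A) : β :=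
  φ (extendWord a (t ∘ Sum.inl)) (extendWord a (t ∘ Sum.inr))

lemma nonempty_letters {Ω : Type*} [MeasurableSpace Ω] (P : Measure Ω) [IsProbabilityMeasure P] (X : ℕ → Ω → A) : Nonempty A := by
  obtain ⟨ω⟩ := P.nonempty_of_neZero
  exact ⟨X 0 ω⟩

/-- This replaces infinite sequences by finite words, to which the finite sums for expectations
apply; the filler letter `a` is irrelevant. -/
lemma IsLocal.eq_onWords {β : Type*} {m n : ℕ} {φ : (ℕ → A) → (ℕ → A) → β} (h : IsLocal m n φ) (a : A)
    {Ω : Type*} {X Y : ℕ → Ω → A} (i j : ℕ) (ω : Ω) :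
    φ (fun t => X (i + t) ω) (fun t => Y (j + t) ω) =
      onWords a m n φ (fun k => Sum.elim X Y (positions i j m n k) ω) := by
  refine h (fun s hs => ?_) (fun s hs => ?_)
  · rw [extendWord_of_lt _ _ hs]; rfl
  · rw [extendWord_of_lt _ _ hs]; rfl

variable {Ω : Type*} [MeasurableSpace Ω] {P : Measure Ω} {X Y : ℕ → Ω → A}
  [MeasurableSpace A] {μ : Measure A}

lemma IsLetterModel.measurable (h : IsLetterModel P μ X Y) (k : ℕ ⊕ ℕ) :
    Measurable (Sum.elim X Y k) := by
  rcases k with k | k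
  exacts [h.measurable_left k, h.measurable_right k]

lemma IsLetterModel.law (h : IsLetterModel P μ X Y) (k : ℕ ⊕ ℕ) :
    P.map (Sum.elim X Y k) = μ := by
  rcases k with k | k
  exacts [h.law_left k, h.law_right k]

variable [Fintype A] [MeasurableSingletonClass A] [IsProbabilityMeasure P]

lemma IsLetterModel.integrable_local (h : IsLetterModel P μ X Y) {m n : ℕ}
    {φ : (ℕ → A) → (ℕ → A) → ℝ} (hφ : IsLocal m n φ) (i j : ℕ) :
    Integrable (fun ω => φ (fun t => X (i + t) ω) (fun t => Y (j + t) ω)) P := by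
  obtain ⟨a⟩ := nonempty_letters P X
  simp only [hφ.eq_onWords a]
  exact integrable_word h.measurable _ _

lemma IsLetterModel.integral_shift (h : IsLetterModel P μ X Y) {m n : ℕ}
    {φ : (ℕ → A) → (ℕ → A) → ℝ} (hφ : IsLocal m n φ) (i j : ℕ) :
    ∫ ω, φ (fun t => X (i + t) ω) (fun t => Y (j + t) ω) ∂P =
      ∫ ω, φ (fun t => X t ω) (fun t => Y t ω) ∂P := by
  obtain ⟨a⟩ := nonempty_letters P X
  have h0 := fun ω => hφ.eq_onWords (X := X) (Y := Y) a 0 0 ω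
  simp only [zero_add] at h0
  simp only [hφ.eq_onWords a, h0]
  rw [integral_word h.measurable h.law h.indep (positions_injective _ _ _ _),
    integral_word h.measurable h.law h.indep (positions_injective _ _ _ _)]

lemma IsLetterModel.integral_mul (h : IsLetterModel P μ X Y) {m₁ n₁ m₂ n₂ : ℕ}
    {φ₁ φ₂ : (ℕ → A) → (ℕ → A) → ℝ} (h₁ : IsLocal m₁ n₁ φ₁) (h₂ : IsLocal m₂ n₂ φ₂) :
    ∫ ω, φ₁ (fun t => X t ω) (fun t => Y t ω) *
        φ₂ (fun t => X (m₁ + t) ω) (fun t => Y (n₁ + t) ω) ∂P =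
      (∫ ω, φ₁ (fun t => X t ω) (fun t => Y t ω) ∂P) *
        ∫ ω, φ₂ (fun t => X t ω) (fun t => Y t ω) ∂P := by
  rw [← h.integral_shift h₂ m₁ n₁]
  obtain ⟨a⟩ := nonempty_letters P X
  have h0 := fun ω => h₁.eq_onWords (X := X) (Y := Y) a 0 0 ω
  simp only [zero_add] at h0
  simp only [h₂.eq_onWords a, h0]
  refine integral_word_mul h.measurable h.law h.indep ?_ _ _
  refine (positions_injective _ _ _ _).sumElim (positions_injective _ _ _ _) ?_
  rintro (a | a) (b | b) e <;> simp [positions] at e <;> omega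

end Sequences

/-- A symmetric similarity matrix bounded by `M` and a subadditive gap penalty that grows faster
than the logarithm. -/
structure IsScoring {A : Type*} (K : A → A → ℝ) (g : ℕ → ℝ) (M : ℝ) : Prop where
  symm : ∀ a b, K a b = K b a
  pos : 0 < M
  le : ∀ a b, K a b ≤ M
  ge : ∀ a b, -M ≤ K a b
  zero : g 0 = 0
  mono : Monotone g
  sub : ∀ a b, g (a + b) ≤ g a + g b
  log : Tendsto (fun k : ℕ => g k / Real.log k) atTop atTop

/-! ### Summability of the exponentiated gap penalties. -/

section Gap

variable {A : Type*} {K : A → A → ℝ} {g : ℕ → ℝ} {M : ℝ}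

lemma IsScoring.nonneg (hs : IsScoring K g M) (k : ℕ) : 0 ≤ g k :=
  hs.zero ▸ hs.mono (Nat.zero_le k)

/-- Eventually `g k ≥ (2 / θ) log k`, so the terms are at most `1 / k ^ 2`. This is where growth
faster than the logarithm is needed, for every `θ > 0`. -/
lemma IsScoring.summable_exp (hs : IsScoring K g M) {θ : ℝ} (hθ : 0 < θ) :
    Summable fun k => Real.exp (-(θ * g k)) := by
  refine Summable.of_norm_bounded_eventually_nat
    (Real.summable_one_div_nat_pow.2 (le_refl 2)) ?_
  filter_upwards [hs.log.eventually_ge_atTop (2 / θ), eventually_ge_atTop 2] with k hk h2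
  have hk1 : (1 : ℝ) < k := by exact_mod_cast h2
  have hlog : 0 < Real.log k := Real.log_pos hk1
  rw [div_le_div_iff₀ hθ hlog] at hk
  rw [Real.norm_eq_abs, abs_of_pos (Real.exp_pos _)]
  have h3 : (1 : ℝ) / (k : ℝ) ^ 2 = Real.exp (-(2 * Real.log k)) := by
    rw [Real.exp_neg, mul_comm, Real.exp_mul, Real.exp_log (by linarith)]
    simp
  rw [h3]
  apply Real.exp_le_exp.2
  linarith

lemma IsScoring.summable_exp_prod (hs : IsScoring K g M) {θ : ℝ} (hθ : 0 < θ) :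
    Summable fun r : ℕ × ℕ => Real.exp (-(θ * g r.1)) * Real.exp (-(θ * g r.2)) :=
  (hs.summable_exp hθ).mul_of_nonneg (hs.summable_exp hθ) (fun _ => (Real.exp_pos _).le)
    fun _ => (Real.exp_pos _).le

end Gap

/-! ### Exponential moments; existence, convexity and slope of ψ. -/

section Moments

section

variable {A : Type*} {Ω : Type*} [MeasurableSpace Ω] {P : Measure Ω} {X Y : ℕ → Ω → A}
  {K : A → A → ℝ} {g : ℕ → ℝ} {κ m n : ℕ} {θ : ℝ}

lemma isLocal_G {β : Type*} (hg0 : g 0 = 0) (hκ : 1 ≤ κ) (hm : κ ≤ m)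
    (hn : κ ≤ n) (F : ℝ → β) : IsLocal m n fun x y => F (G K g κ x y m n).toReal :=
  fun _ _ _ _ hx hy => congrArg F (G_congr hg0 hκ hm hn hx hy)

lemma expMoment_nonneg : 0 ≤ expMoment P X Y K g κ m n θ :=
  integral_nonneg fun _ => (Real.exp_pos _).le

lemma expMoment_zero [IsProbabilityMeasure P] : expMoment P X Y K g κ m n 0 = 1 := by
  simp [expMoment]

end

variable {A : Type*} [Fintype A] [MeasurableSpace A] [MeasurableSingletonClass A]
  {Ω : Type*} [MeasurableSpace Ω] {P : Measure Ω} [IsProbabilityMeasure P] {μ : Measure A}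
  {X Y : ℕ → Ω → A} {K : A → A → ℝ} {g : ℕ → ℝ} {M : ℝ} {κ m n : ℕ} {θ : ℝ}

lemma IsLetterModel.integrable_exp (h : IsLetterModel P μ X Y) (hs : IsScoring K g M)
    (hκ : 1 ≤ κ) (hm : κ ≤ m) (hn : κ ≤ n) (θ : ℝ) :
    Integrable (fun ω => Real.exp (θ * (G K g κ (fun i => X i ω) (fun j => Y j ω) m n).toReal))
      P := by
  have := h.integrable_local (isLocal_G (K := K) hs.zero hκ hm hn fun s => Real.exp (θ * s)) 0 0
  simpa using this

/-- A part of the score may be traded for the deterministic bound. -/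
lemma IsLetterModel.expMoment_add_le (h : IsLetterModel P μ X Y) (hs : IsScoring K g M)
    (hκ : 1 ≤ κ) {a : ℝ} (ha : 0 ≤ a) (b : ℝ) (r : ℕ × ℕ) :
    expMoment P X Y K g κ (κ + r.1) (κ + r.2) (a + b) ≤
      Real.exp (a * M * κ) * (Real.exp (-(a * g r.1)) * Real.exp (-(a * g r.2))) *
        expMoment P X Y K g κ (κ + r.1) (κ + r.2) b := by
  unfold expMoment
  rw [← integral_const_mul]
  have h1 : κ ≤ κ + r.1 := Nat.le_add_right _ _
  have h2 : κ ≤ κ + r.2 := Nat.le_add_right _ _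
  refine integral_mono (h.integrable_exp hs hκ h1 h2 _)
    ((h.integrable_exp hs hκ h1 h2 _).const_mul _) fun ω => ?_
  simp only [← Real.exp_add]
  apply Real.exp_le_exp.2
  have h3 := G_le (x := fun i => X i ω) (y := fun j => Y j ω) hs.zero hs.mono hs.sub hs.le hκ h1 h2
  simp only [Nat.add_sub_cancel_left] at h3
  have := mul_le_mul_of_nonneg_left h3 ha
  linarith

lemma IsLetterModel.expMoment_le (h : IsLetterModel P μ X Y) (hs : IsScoring K g M)
    (hκ : 1 ≤ κ) (hθ : 0 ≤ θ) (r : ℕ × ℕ) :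
    expMoment P X Y K g κ (κ + r.1) (κ + r.2) θ ≤
      Real.exp (θ * M * κ) * (Real.exp (-(θ * g r.1)) * Real.exp (-(θ * g r.2))) := by
  simpa [expMoment_zero] using h.expMoment_add_le hs hκ hθ 0 r

lemma IsLetterModel.summable_expMoment (h : IsLetterModel P μ X Y) (hs : IsScoring K g M)
    (hκ : 1 ≤ κ) (hθ : 0 < θ) :
    Summable fun r : ℕ × ℕ => expMoment P X Y K g κ (κ + r.1) (κ + r.2) θ :=
  Summable.of_nonneg_of_le (fun _ => expMoment_nonneg) (h.expMoment_le hs hκ hθ.le)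
    ((hs.summable_exp_prod hθ).mul_left _)

/-- The single term `m = n = κ` suffices, where the diagonal path has no gaps. -/
lemma IsLetterModel.h_pos_ge (h : IsLetterModel P μ X Y) (hs : IsScoring K g M)
    (hκ : 1 ≤ κ) (hθ : 0 < θ) :
    Real.exp (-(θ * M * κ)) ≤ LocalAlignment.h P X Y K g κ θ := by
  refine le_trans ?_ ((h.summable_expMoment hs hκ hθ).le_tsum (0, 0)
    fun _ _ => expMoment_nonneg)
  have h1 : Real.exp (-(θ * M * κ)) = ∫ _ω : Ω, Real.exp (-(θ * M * κ)) ∂P := by simp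
  rw [h1]
  refine integral_mono (integrable_const _) (h.integrable_exp hs hκ le_rfl le_rfl _) fun ω => ?_
  apply Real.exp_le_exp.2
  have := mul_le_mul_of_nonneg_left (G_self_ge (x := fun i => X i ω) (y := fun j => Y j ω)
    (K := K) hs.zero hs.ge hκ) hθ.le
  simp only [add_zero]
  linarith

lemma IsLetterModel.h_pos (h : IsLetterModel P μ X Y) (hs : IsScoring K g M)
    (hκ : 1 ≤ κ) (hθ : 0 < θ) : 0 < LocalAlignment.h P X Y K g κ θ :=
  (Real.exp_pos _).trans_le (h.h_pos_ge hs hκ hθ)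

lemma IsLetterModel.exp_psiK (h : IsLetterModel P μ X Y) (hs : IsScoring K g M)
    (hκ : 1 ≤ κ) (hθ : 0 < θ) :
    Real.exp (psiK P X Y K g κ θ) = LocalAlignment.h P X Y K g κ θ :=
  Real.exp_log (h.h_pos hs hκ hθ)

-- The lengths exceeding `κ` in the two sequences are split simultaneously, so sums over cuts are
-- Cauchy products over `ℕ × ℕ`.
local instance prodAntidiagonal : Finset.HasAntidiagonal (ℕ × ℕ) where
  antidiagonal r := (Finset.Iic r ×ˢ Finset.Iic r).filter fun q => q.1 + q.2 = r
  mem_antidiagonal := by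
    intro r q
    simp only [Finset.mem_filter, Finset.mem_product, Finset.mem_Iic, and_iff_right_iff_imp]
    rintro rfl
    exact ⟨le_self_add, le_add_self⟩

lemma tsum_le_tsum_mul_tsum {f f₁ f₂ : ℕ × ℕ → ℝ} (hf : Summable f) (hf₁ : Summable f₁)
    (hf₂ : Summable f₂) (h₁ : ∀ r, 0 ≤ f₁ r) (h₂ : ∀ r, 0 ≤ f₂ r)
    (hle : ∀ r, f r ≤ ∑ q ∈ Finset.HasAntidiagonal.antidiagonal r, f₁ q.1 * f₂ q.2) :
    ∑' r, f r ≤ (∑' r, f₁ r) * ∑' r, f₂ r := by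
  have hmul : Summable fun q : (ℕ × ℕ) × (ℕ × ℕ) => f₁ q.1 * f₂ q.2 :=
    hf₁.mul_of_nonneg hf₂ h₁ h₂
  rw [hf₁.tsum_mul_tsum_eq_tsum_sum_antidiagonal hf₂ hmul]
  exact hf.tsum_le_tsum hle (summable_sum_mul_antidiagonal_of_summable_mul hmul)

/-- For each outcome some cut makes the score at most the sum of the two partial scores; bounding by
the sum over all cuts, each term factors since the two parts use disjoint letters. -/
lemma IsLetterModel.expMoment_split_le (h : IsLetterModel P μ X Y) (hs : IsScoring K g M)
    {κ₁ κ₂ : ℕ} (hκ₁ : 1 ≤ κ₁) (hκ₂ : 1 ≤ κ₂) (hθ : 0 < θ) (r : ℕ × ℕ) :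
    expMoment P X Y K g (κ₁ + κ₂) (κ₁ + κ₂ + r.1) (κ₁ + κ₂ + r.2) θ ≤
      ∑ q ∈ Finset.HasAntidiagonal.antidiagonal r, expMoment P X Y K g κ₁ (κ₁ + q.1.1) (κ₁ + q.1.2) θ *
        expMoment P X Y K g κ₂ (κ₂ + q.2.1) (κ₂ + q.2.2) θ := by
  have hloc : ∀ (κ : ℕ), 1 ≤ κ → ∀ q : ℕ × ℕ, IsLocal (κ + q.1) (κ + q.2)
      fun x y => Real.exp (θ * (G K g κ x y (κ + q.1) (κ + q.2)).toReal) := fun κ hκ q =>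
    isLocal_G hs.zero hκ (Nat.le_add_right _ _) (Nat.le_add_right _ _) fun s => Real.exp (θ * s)
  have hmul := fun q : (ℕ × ℕ) × (ℕ × ℕ) => h.integral_mul (hloc κ₁ hκ₁ q.1) (hloc κ₂ hκ₂ q.2)
  have hint : ∀ q : (ℕ × ℕ) × (ℕ × ℕ), Integrable (fun ω =>
      Real.exp (θ * (G K g κ₁ (fun t => X t ω) (fun t => Y t ω)
        (κ₁ + q.1.1) (κ₁ + q.1.2)).toReal) *
      Real.exp (θ * (G K g κ₂ (fun t => X (κ₁ + q.1.1 + t) ω) (fun t => Y (κ₁ + q.1.2 + t) ω)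
        (κ₂ + q.2.1) (κ₂ + q.2.2)).toReal)) P := by
    intro q
    have hl : IsLocal (κ₁ + q.1.1 + (κ₂ + q.2.1)) (κ₁ + q.1.2 + (κ₂ + q.2.2)) fun x y =>
        Real.exp (θ * (G K g κ₁ x y (κ₁ + q.1.1) (κ₁ + q.1.2)).toReal) *
        Real.exp (θ * (G K g κ₂ (fun t => x (κ₁ + q.1.1 + t)) (fun t => y (κ₁ + q.1.2 + t))
        (κ₂ + q.2.1) (κ₂ + q.2.2)).toReal) := by
      intro x x' y y' hx hy
      have e1 := hloc κ₁ hκ₁ q.1 (x := x) (x' := x') (y := y) (y' := y')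
        (fun i hi => hx i (by omega)) (fun i hi => hy i (by omega))
      have e2 := hloc κ₂ hκ₂ q.2 (x := fun t => x (κ₁ + q.1.1 + t))
        (x' := fun t => x' (κ₁ + q.1.1 + t)) (y := fun t => y (κ₁ + q.1.2 + t))
        (y' := fun t => y' (κ₁ + q.1.2 + t))
        (fun i hi => hx _ (by omega)) (fun i hi => hy _ (by omega))
      simp only at e1 e2 ⊢
      rw [e1, e2]
    have := h.integrable_local hl 0 0
    simpa using this
  have hrw : ∑ q ∈ Finset.HasAntidiagonal.antidiagonal r, expMoment P X Y K g κ₁ (κ₁ + q.1.1) (κ₁ + q.1.2) θ *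
        expMoment P X Y K g κ₂ (κ₂ + q.2.1) (κ₂ + q.2.2) θ =
      ∫ ω, ∑ q ∈ Finset.HasAntidiagonal.antidiagonal r,
      Real.exp (θ * (G K g κ₁ (fun t => X t ω) (fun t => Y t ω)
        (κ₁ + q.1.1) (κ₁ + q.1.2)).toReal) *
      Real.exp (θ * (G K g κ₂ (fun t => X (κ₁ + q.1.1 + t) ω) (fun t => Y (κ₁ + q.1.2 + t) ω)
        (κ₂ + q.2.1) (κ₂ + q.2.2)).toReal) ∂P := by
    rw [integral_finsetSum _ fun q _ => hint q]
    exact Finset.sum_congr rfl fun q _ => (hmul q).symm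
  rw [hrw]
  refine integral_mono (h.integrable_exp hs (by omega) (Nat.le_add_right _ _)
    (Nat.le_add_right _ _) _) (integrable_finsetSum _ fun q _ => hint q) fun ω => ?_
  obtain ⟨m₁, n₁, m₂, n₂, em, en, h1, h2, h3, h4, hG⟩ := exists_G_le_add (K := K) (g := g)
    (x := fun i => X i ω) (y := fun j => Y j ω) hs.zero hκ₁ hκ₂
    (Nat.le_add_right (κ₁ + κ₂) r.1) (Nat.le_add_right (κ₁ + κ₂) r.2)
  have hq : (((m₁ - κ₁, n₁ - κ₁), (m₂ - κ₂, n₂ - κ₂)) : (ℕ × ℕ) × (ℕ × ℕ)) ∈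
      Finset.HasAntidiagonal.antidiagonal r := by
    rw [Finset.HasAntidiagonal.mem_antidiagonal]
    ext <;> simp <;> omega
  refine le_trans ?_ (Finset.single_le_sum (f := fun q : (ℕ × ℕ) × (ℕ × ℕ) =>
    Real.exp (θ * (G K g κ₁ (fun t => X t ω) (fun t => Y t ω)
        (κ₁ + q.1.1) (κ₁ + q.1.2)).toReal) *
      Real.exp (θ * (G K g κ₂ (fun t => X (κ₁ + q.1.1 + t) ω) (fun t => Y (κ₁ + q.1.2 + t) ω)
        (κ₂ + q.2.1) (κ₂ + q.2.2)).toReal)) (fun q _ => by positivity) hq)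
  simp only [Nat.add_sub_cancel' h1, Nat.add_sub_cancel' h2, Nat.add_sub_cancel' h3,
    Nat.add_sub_cancel' h4]
  rw [← Real.exp_add, ← mul_add]
  exact Real.exp_le_exp.2 (mul_le_mul_of_nonneg_left hG hθ.le)

lemma IsLetterModel.h_add_le (h : IsLetterModel P μ X Y) (hs : IsScoring K g M)
    {κ₁ κ₂ : ℕ} (hκ₁ : 1 ≤ κ₁) (hκ₂ : 1 ≤ κ₂) (hθ : 0 < θ) :
    LocalAlignment.h P X Y K g (κ₁ + κ₂) θ ≤
      LocalAlignment.h P X Y K g κ₁ θ * LocalAlignment.h P X Y K g κ₂ θ := by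
  exact tsum_le_tsum_mul_tsum (h.summable_expMoment hs (by omega) hθ)
    (h.summable_expMoment hs hκ₁ hθ) (h.summable_expMoment hs hκ₂ hθ)
    (fun _ => expMoment_nonneg) (fun _ => expMoment_nonneg) (h.expMoment_split_le hs hκ₁ hκ₂ hθ)

lemma IsLetterModel.tendsto_psi (h : IsLetterModel P μ X Y) (hs : IsScoring K g M)
    (hθ : 0 < θ) :
    Tendsto (fun κ : ℕ => psiK P X Y K g κ θ / κ) atTop (𝓝 (psi P X Y K g θ)) := by
  -- The value at `κ = 0` is reset to `0`, which makes subadditivity trivial there and does not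
  -- affect the limit.
  let u : ℕ → ℝ := fun κ => if κ = 0 then 0 else psiK P X Y K g κ θ
  have hu : Subadditive u := by
    intro κ₁ κ₂
    rcases Nat.eq_zero_or_pos κ₁ with rfl | h1
    · simp [u]
    rcases Nat.eq_zero_or_pos κ₂ with rfl | h2
    · simp [u]
    simp only [u, h1.ne', h2.ne', (Nat.add_pos_left h1 κ₂).ne', if_false, psiK]
    rw [← Real.log_mul (h.h_pos hs h1 hθ).ne' (h.h_pos hs h2 hθ).ne']
    exact Real.log_le_log (h.h_pos hs (by omega) hθ) (h.h_add_le hs h1 h2 hθ)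
  have hb : BddBelow (Set.range fun κ => u κ / κ) := by
    refine ⟨-(θ * M), ?_⟩
    rintro _ ⟨κ, rfl⟩
    rcases Nat.eq_zero_or_pos κ with rfl | h1
    · simpa [u] using (mul_pos hθ hs.pos).le
    simp only [u, h1.ne', if_false]
    rw [le_div_iff₀ (by exact_mod_cast h1), psiK,
      Real.le_log_iff_exp_le (h.h_pos hs h1 hθ), neg_mul]
    exact h.h_pos_ge hs h1 hθ
  have ht : Tendsto (fun κ : ℕ => psiK P X Y K g κ θ / κ) atTop (𝓝 hu.lim) := by
    refine (hu.tendsto_lim hb).congr' ?_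
    filter_upwards [eventually_gt_atTop 0] with κ hκ
    simp [u, hκ.ne']
  exact tendsto_nhds_limUnder ⟨_, ht⟩

lemma IsLetterModel.psi_le_of_h_le (h : IsLetterModel P μ X Y) (hs : IsScoring K g M)
    (hθ : 0 < θ) {C c : ℝ} (hC : 0 < C)
    (hle : ∀ κ : ℕ, 1 ≤ κ → LocalAlignment.h P X Y K g κ θ ≤ C * Real.exp (c * κ)) :
    psi P X Y K g θ ≤ c := by
  have h1 : Tendsto (fun κ : ℕ => Real.log C / κ + c) atTop (𝓝 (0 + c)) :=
    (tendsto_const_div_atTop_nhds_zero_nat _).add tendsto_const_nhds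
  rw [zero_add] at h1
  refine le_of_tendsto_of_tendsto (h.tendsto_psi hs hθ) h1 ?_
  filter_upwards [eventually_ge_atTop 1] with κ hκ
  have hκ' : (0 : ℝ) < κ := by exact_mod_cast hκ
  rw [div_le_iff₀ hκ', add_mul, div_mul_cancel₀ _ hκ'.ne', psiK,
    Real.log_le_iff_le_exp (h.h_pos hs hκ hθ), Real.exp_add, Real.exp_log hC]
  exact hle κ hκ

lemma IsLetterModel.psi_le (h : IsLetterModel P μ X Y) (hs : IsScoring K g M)
    (hθ : 0 < θ) : psi P X Y K g θ ≤ θ * M := by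
  have hsum := hs.summable_exp_prod hθ
  refine h.psi_le_of_h_le hs hθ (C := ∑' r : ℕ × ℕ,
    Real.exp (-(θ * g r.1)) * Real.exp (-(θ * g r.2)))
    (hsum.tsum_pos (fun _ => by positivity) (0, 0) (by positivity)) fun κ hκ => ?_
  rw [mul_comm, ← tsum_mul_left]
  exact (h.summable_expMoment hs hκ hθ).tsum_le_tsum (h.expMoment_le hs hκ hθ.le)
    (hsum.mul_left _)

/-- This is Hölder's inequality, obtained from convexity of `exp` at `a * G - α` and `b * G - β`:
with `α = psiK a` and `β = psiK b` the two normalized sums equal `1`, so the total is at most `s + t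
= 1`. -/
lemma IsLetterModel.psiK_convex (h : IsLetterModel P μ X Y) (hs : IsScoring K g M)
    (hκ : 1 ≤ κ) {a b s t : ℝ} (ha : 0 < a) (hb : 0 < b) (hs0 : 0 ≤ s) (ht : 0 ≤ t)
    (hst : s + t = 1) :
    psiK P X Y K g κ (s * a + t * b) ≤
      s * psiK P X Y K g κ a + t * psiK P X Y K g κ b := by
  have hc : 0 < s * a + t * b := by
    rcases hs0.eq_or_lt with rfl | hs0
    · have : t = 1 := by linarith
      subst this; linarith
    · have := mul_pos hs0 ha
      have := mul_nonneg ht hb.le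
      linarith
  set α := psiK P X Y K g κ a
  set β := psiK P X Y K g κ b
  have hea := h.exp_psiK hs hκ ha
  have heb := h.exp_psiK hs hκ hb
  have hsa := h.summable_expMoment hs hκ ha
  have hsb := h.summable_expMoment hs hκ hb
  have key : ∀ r : ℕ × ℕ, expMoment P X Y K g κ (κ + r.1) (κ + r.2) (s * a + t * b) *
      Real.exp (-(s * α + t * β)) ≤
      s * Real.exp (-α) * expMoment P X Y K g κ (κ + r.1) (κ + r.2) a +
        t * Real.exp (-β) * expMoment P X Y K g κ (κ + r.1) (κ + r.2) b := by
    intro r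
    have hi := h.integrable_exp hs hκ (Nat.le_add_right κ r.1) (Nat.le_add_right κ r.2)
    unfold expMoment
    rw [← integral_mul_const, ← integral_const_mul, ← integral_const_mul,
      ← integral_add ((hi a).const_mul _) ((hi b).const_mul _)]
    refine integral_mono ((hi _).mul_const _) (((hi a).const_mul _).add ((hi b).const_mul _))
      fun ω => ?_
    generalize (G K g κ (fun i => X i ω) (fun j => Y j ω) (κ + r.1) (κ + r.2)).toReal = G
    have := convexOn_exp.2 (Set.mem_univ (a * G - α)) (Set.mem_univ (b * G - β)) hs0 ht hst
    simp only [smul_eq_mul, sub_eq_add_neg, Real.exp_add (a * G), Real.exp_add (b * G)] at this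
    rw [← Real.exp_add]
    calc _ = Real.exp (s * (a * G + -α) + t * (b * G + -β)) := by congr 1; ring
      _ ≤ _ := this
      _ = _ := by ring
  have h1 := ((h.summable_expMoment hs hκ hc).mul_right _).tsum_le_tsum key
    ((hsa.mul_left _).add (hsb.mul_left _))
  rw [tsum_mul_right, (hsa.mul_left _).tsum_add (hsb.mul_left _), tsum_mul_left,
    tsum_mul_left] at h1
  change LocalAlignment.h P X Y K g κ _ * _ ≤ _ * LocalAlignment.h P X Y K g κ a +
    _ * LocalAlignment.h P X Y K g κ b at h1
  rw [← hea, ← heb, mul_assoc, mul_assoc, ← Real.exp_add, ← Real.exp_add, neg_add_cancel,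
    neg_add_cancel, Real.exp_zero, mul_one, mul_one, hst, ← h.exp_psiK hs hκ hc, ← Real.exp_add,
    Real.exp_le_one_iff] at h1
  linarith

lemma IsLetterModel.convexOn_psi (h : IsLetterModel P μ X Y) (hs : IsScoring K g M) :
    ConvexOn ℝ (Set.Ioi 0) (psi P X Y K g) := by
  refine ⟨convex_Ioi 0, fun a ha b hb s t hs0 ht hst => ?_⟩
  have hc := (convex_Ioi (0 : ℝ)) ha hb hs0 ht hst
  simp only [smul_eq_mul] at hc ⊢
  refine le_of_tendsto_of_tendsto (h.tendsto_psi hs hc)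
    (((h.tendsto_psi hs ha).const_mul s).add ((h.tendsto_psi hs hb).const_mul t)) ?_
  filter_upwards [eventually_ge_atTop 1] with κ hκ
  have hκ' : (0 : ℝ) < κ := by exact_mod_cast hκ
  rw [← mul_div_assoc, ← mul_div_assoc, ← add_div]
  exact div_le_div_of_nonneg_right (h.psiK_convex hs hκ ha hb hs0 ht hst) hκ'.le

/-- If the slope at `θ` were not positive, convexity would force `ψ ≥ 0` at `θ / 2`. But `ψ(s) ≤ s
M` tends to `0` at the origin, and with `ψ(θ) = 0` convexity gives `ψ ≤ 0` at `θ / 2`, a second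
root. -/
lemma IsLetterModel.deriv_psi_pos (h : IsLetterModel P μ X Y) (hs : IsScoring K g M)
    (hθ : 0 < θ) (h0 : psi P X Y K g θ = 0)
    (huniq : ∀ t : ℝ, 0 < t → psi P X Y K g t = 0 → t = θ)
    (hd : DifferentiableAt ℝ (psi P X Y K g) θ) : 0 < deriv (psi P X Y K g) θ := by
  by_contra hneg
  push Not at hneg
  have hconv := h.convexOn_psi hs
  have h2 : 0 < θ / 2 := by linarith
  have hge : 0 ≤ psi P X Y K g (θ / 2) := by
    have := hconv.slope_le_of_hasDerivAt (x := θ / 2) (y := θ) h2 hθ (by linarith) hd.hasDerivAt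
    rw [slope_def_field, h0, div_le_iff₀ (by linarith)] at this
    nlinarith
  have hle : psi P X Y K g (θ / 2) ≤ 0 := by
    refine le_of_forall_pos_le_add fun ε hε => ?_
    -- Then `θ / 2` lies between `s` and `θ`, and `ψ(s) ≤ s M ≤ ε`.
    set s := min (θ / 4) (ε / M) with hsdef
    have hs0 : 0 < s := lt_min (by linarith) (div_pos hε hs.pos)
    have hsθ : s ≤ θ / 4 := min_le_left _ _
    have hsM : s * M ≤ ε := by
      rw [← le_div_iff₀ hs.pos]; exact min_le_right _ _
    have hd0 : 0 < θ - s := by linarith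
    have hw0 : 0 ≤ θ / 2 / (θ - s) := by positivity
    have hw1 : 0 ≤ 1 - θ / 2 / (θ - s) := by rw [sub_nonneg, div_le_one hd0]; linarith
    have hcv := hconv.2 (Set.mem_Ioi.2 hs0) (Set.mem_Ioi.2 hθ) hw0 hw1 (by ring)
    have he : (θ / 2 / (θ - s)) • s + (1 - θ / 2 / (θ - s)) • θ = θ / 2 := by
      simp only [smul_eq_mul]; field_simp; ring
    rw [he, h0, smul_zero, add_zero, smul_eq_mul] at hcv
    have hf : θ / 2 / (θ - s) ≤ 1 := by rw [div_le_one hd0]; linarith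
    have hf0 : 0 ≤ θ / 2 / (θ - s) := by positivity
    have := h.psi_le hs hs0
    nlinarith
  have := huniq _ h2 (le_antisymm hle hge)
  linarith

end Moments

/-! ### The almost sure upper bound for penalized scores. -/

section UpperBound

lemma ae_eventually_notMem_of_summable {Ω : Type*} [MeasurableSpace Ω] {P : Measure Ω}
    [IsFiniteMeasure P] {s : ℕ → Set Ω} {b : ℕ → ℝ} (hb : Summable b)
    (h : ∀ᶠ k in atTop, P.real (s k) ≤ b k) : ∀ᵐ ω ∂P, ∀ᶠ k in atTop, ω ∉ s k := by
  have h1 : Summable fun k => P.real (s k) :=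
    Summable.of_norm_bounded_eventually_nat hb (h.mono fun k hk => by
      rwa [Real.norm_of_nonneg measureReal_nonneg])
  apply ae_eventually_notMem
  have h2 : ∀ k, ENNReal.ofReal (P.real (s k)) = P (s k) := fun k => ofReal_measureReal
  simpa only [h2] using h1.tsum_ofReal_ne_top

variable {A : Type*} [Fintype A] [MeasurableSpace A] [MeasurableSingletonClass A]
  {Ω : Type*} [MeasurableSpace Ω] {P : Measure Ω} [IsProbabilityMeasure P] {μ : Measure A}
  {X Y : ℕ → Ω → A} {K : A → A → ℝ} {g : ℕ → ℝ} {M : ℝ} {θ τ : ℝ}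

lemma IsLetterModel.summable_h_mul_exp (h : IsLetterModel P μ X Y) (hs : IsScoring K g M)
    (hθ : 0 < θ) (hτ : psi P X Y K g θ < τ) :
    Summable fun κ : ℕ => LocalAlignment.h P X Y K g κ θ * Real.exp (-(τ * κ)) := by
  obtain ⟨τ', h1, h2⟩ := exists_between hτ
  have hgeo : Summable fun κ : ℕ => Real.exp (-(τ - τ')) ^ κ :=
    summable_geometric_of_lt_one (Real.exp_pos _).le (Real.exp_lt_one_iff.2 (by linarith))
  refine Summable.of_norm_bounded_eventually_nat hgeo ?_
  filter_upwards [(h.tendsto_psi hs hθ).eventually_lt_const h1, eventually_ge_atTop 1] with κ hκ h1κ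
  have hκ' : (0 : ℝ) < κ := by exact_mod_cast h1κ
  rw [div_lt_iff₀ hκ'] at hκ
  rw [← h.exp_psiK hs h1κ hθ, ← Real.exp_add, Real.norm_of_nonneg (Real.exp_pos _).le,
    ← Real.exp_nat_mul]
  apply Real.exp_le_exp.2
  linarith

/-- The event that some alignment of the first `N` letters has a large penalized score. -/
def highScore (X Y : ℕ → Ω → A) (K : A → A → ℝ) (g : ℕ → ℝ) (θ τ : ℝ) (N : ℕ) (r : ℝ) : Set Ω :=
  {ω | ∃ z : Alignment, z.Fits N N ∧
    r ≤ θ * rawScore K g (fun i => X i ω) (fun j => Y j ω) z - τ * z.card}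

/-- Union bound and Markov's inequality: starting positions contribute `N ^ 2`, while the sums over
lengths and numbers of matches are bounded by the convergent series. -/
lemma IsLetterModel.highScore_le (h : IsLetterModel P μ X Y) (hs : IsScoring K g M)
    (hθ : 0 < θ) (hτ : psi P X Y K g θ < τ) (N : ℕ) (r : ℝ) :
    P.real (highScore X Y K g θ τ N r) ≤
      (∑' κ : ℕ, LocalAlignment.h P X Y K g (κ + 1) θ * Real.exp (-(τ * (κ + 1 : ℕ)))) *
        (N : ℝ) ^ 2 * Real.exp (-r) := by
  have hsum := (summable_nat_add_iff 1).2 (h.summable_h_mul_exp hs hθ hτ)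
  -- The indices are the starting positions in both sequences, then the number of matches minus one
  -- and the two excess lengths.
  let S := ((Finset.range N ×ˢ Finset.range N) ×ˢ
    (Finset.range N ×ˢ (Finset.range N ×ˢ Finset.range N)))
  let F : (ℕ × ℕ) × (ℕ × (ℕ × ℕ)) → Ω → ℝ := fun q ω => Real.exp (θ * (G K g (q.2.1 + 1)
    (fun t => X (q.1.1 + t) ω) (fun t => Y (q.1.2 + t) ω) (q.2.1 + 1 + q.2.2.1)
    (q.2.1 + 1 + q.2.2.2)).toReal)
  let c : ℕ → ℝ := fun κ => Real.exp (-(τ * (κ + 1 : ℕ))) * Real.exp (-r)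
  have hloc : ∀ q : (ℕ × ℕ) × (ℕ × (ℕ × ℕ)), IsLocal (q.2.1 + 1 + q.2.2.1) (q.2.1 + 1 + q.2.2.2)
      fun x y => Real.exp (θ * (G K g (q.2.1 + 1) x y (q.2.1 + 1 + q.2.2.1)
        (q.2.1 + 1 + q.2.2.2)).toReal) := fun q =>
    isLocal_G hs.zero (by omega) (by omega) (by omega) fun s => Real.exp (θ * s)
  have hint : ∀ q, Integrable (F q) P := fun q => h.integrable_local (hloc q) q.1.1 q.1.2
  have hval : ∀ q, ∫ ω, F q ω ∂P =
      expMoment P X Y K g (q.2.1 + 1) (q.2.1 + 1 + q.2.2.1) (q.2.1 + 1 + q.2.2.2) θ :=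
    fun q => h.integral_shift (hloc q) q.1.1 q.1.2
  have hsub : highScore X Y K g θ τ N r ⊆ {ω | 1 ≤ ∑ q ∈ S, c q.2.1 * F q ω} := by
    rintro ω ⟨z, hz, hr⟩
    obtain ⟨i, j, m, n, hi, hj, hc1, hcm, hcn, hle⟩ := rawScore_le_G (K := K)
      (x := fun i => X i ω) (y := fun j => Y j ω) hs.zero hz
    have hq : ((i, j), (z.card - 1, (m - z.card, n - z.card))) ∈ S := by
      simp only [S, Finset.mem_product, Finset.mem_range]
      omega
    refine le_trans ?_ (Finset.single_le_sum (f := fun q => c q.2.1 * F q ω)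
      (fun q _ => by positivity) hq)
    simp only [c, F, Nat.sub_add_cancel hc1, Nat.add_sub_cancel' hcm, Nat.add_sub_cancel' hcn,
      ← Real.exp_add]
    rw [Real.one_le_exp_iff]
    have := mul_le_mul_of_nonneg_left hle hθ.le
    linarith
  have hmarkov := mul_meas_ge_le_integral_of_nonneg (μ := P)
    (f := fun ω => ∑ q ∈ S, c q.2.1 * F q ω)
    (Eventually.of_forall fun ω => Finset.sum_nonneg fun q _ => by positivity)
    (integrable_finsetSum _ fun q _ => (hint q).const_mul _) 1
  rw [one_mul] at hmarkov
  refine (measureReal_mono hsub).trans (hmarkov.trans ?_)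
  rw [integral_finsetSum _ fun q _ => (hint q).const_mul _]
  simp only [integral_const_mul, hval, S]
  rw [Finset.sum_product]
  simp only [Finset.sum_const, Finset.card_product, Finset.card_range, nsmul_eq_mul]
  have hκ : ∑ a ∈ Finset.range N ×ˢ (Finset.range N ×ˢ Finset.range N), c a.1 *
      expMoment P X Y K g (a.1 + 1) (a.1 + 1 + a.2.1) (a.1 + 1 + a.2.2) θ ≤
      (∑' κ : ℕ, LocalAlignment.h P X Y K g (κ + 1) θ * Real.exp (-(τ * (κ + 1 : ℕ)))) *
        Real.exp (-r) := by
    rw [Finset.sum_product, ← tsum_mul_right]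
    refine le_trans (Finset.sum_le_sum fun κ _ => ?_)
      ((hsum.mul_right _).sum_le_tsum (Finset.range N) fun κ _ => ?_)
    · simp only [← Finset.mul_sum]
      have := (h.summable_expMoment hs (Nat.le_add_left 1 κ) hθ).sum_le_tsum
        (Finset.range N ×ˢ Finset.range N) fun _ _ => expMoment_nonneg
      refine (mul_le_mul_of_nonneg_left this (by positivity)).trans (le_of_eq ?_)
      simp only [c, LocalAlignment.h]
      ring
    · have := (h.h_pos hs (Nat.le_add_left 1 κ) hθ).le
      positivity
  refine (mul_le_mul_of_nonneg_left hκ (by positivity)).trans (le_of_eq ?_)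
  push_cast
  ring

/-- Almost surely, the penalized scores are eventually bounded by `(2 + ε) log n`. -/
lemma IsLetterModel.ae_eventually_score_le (h : IsLetterModel P μ X Y) (hs : IsScoring K g M)
    (hθ : 0 < θ) (hτ : psi P X Y K g θ < τ) {ε : ℝ} (hε : 0 < ε) :
    ∀ᵐ ω ∂P, ∀ᶠ n : ℕ in atTop, ∀ z : Alignment, z.Fits n n →
      θ * rawScore K g (fun i => X i ω) (fun j => Y j ω) z - τ * z.card ≤
        (2 + ε) * Real.log n := by
  set C := ∑' κ : ℕ, LocalAlignment.h P X Y K g (κ + 1) θ * Real.exp (-(τ * (κ + 1 : ℕ)))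
  have hlog2 : 0 < Real.log 2 := Real.log_pos one_lt_two
  have hgeo : Summable fun k : ℕ => 4 * C * Real.exp (-(ε * Real.log 2)) ^ k :=
    (summable_geometric_of_lt_one (Real.exp_pos _).le
      (Real.exp_lt_one_iff.2 (by have := mul_pos hε hlog2; linarith))).mul_left _
  -- Borel–Cantelli along powers of two: for `2 ^ k ≤ n < 2 ^ (k + 1)` alignments are placed in the
  -- larger box and `log n` is replaced by the smaller `k log 2`, at the cost of the factor `4`.
  have hbc := ae_eventually_notMem_of_summable (P := P)
    (s := fun k => highScore X Y K g θ τ (2 ^ (k + 1)) ((2 + ε) * (k * Real.log 2))) hgeo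
    (Eventually.of_forall fun k => ?_)
  · filter_upwards [hbc] with ω hω
    have hnat : Tendsto (Nat.log 2) atTop atTop := by
      refine tendsto_atTop.2 fun b => ?_
      filter_upwards [eventually_ge_atTop (2 ^ b)] with n hn
      exact Nat.le_log_of_pow_le one_lt_two hn
    filter_upwards [hnat.eventually hω, eventually_ge_atTop 1] with n hn h1n z hz
    by_contra hlt
    push Not at hlt
    have hpow : (2 : ℝ) ^ Nat.log 2 n ≤ n := by
      exact_mod_cast Nat.pow_log_le_self 2 (by omega)
    have hlogle : Nat.log 2 n * Real.log 2 ≤ Real.log n := by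
      rw [← Real.log_pow]
      exact Real.log_le_log (by positivity) hpow
    have hup := Nat.lt_pow_succ_log_self one_lt_two n
    refine hn ⟨z, ⟨hz.1.trans hup, hz.2.trans hup⟩, le_trans ?_ hlt.le⟩
    exact mul_le_mul_of_nonneg_left hlogle (by linarith)
  · refine (h.highScore_le hs hθ hτ _ _).trans (le_of_eq ?_)
    have e1 : Real.exp (-((2 + ε) * (k * Real.log 2))) =
        Real.exp (-(ε * Real.log 2)) ^ k * ((2 : ℝ) ^ k)⁻¹ ^ 2 := by
      rw [← Real.exp_nat_mul, show ((2 : ℝ) ^ k)⁻¹ ^ 2 = Real.exp (-(2 * k * Real.log 2)) by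
        rw [Real.exp_neg, inv_pow, ← pow_mul, show (2 * k * Real.log 2 : ℝ) =
          ((k * 2 : ℕ) : ℝ) * Real.log 2 by push_cast; ring, Real.exp_nat_mul,
          Real.exp_log two_pos], ← Real.exp_add]
      congr 1; ring
    change C * ((2 ^ (k + 1) : ℕ) : ℝ) ^ 2 * _ = _
    rw [e1]
    clear_value C
    push_cast
    have : (2 : ℝ) ^ k ≠ 0 := by positivity
    field_simp
    ring

end UpperBound

/-! ### Probabilities of large scores where ψ is positive. -/

section LargeScores

/-- The indicator of the event that `G_κ` is at least `s`. -/
def largeG {A : Type*} (K : A → A → ℝ) (g : ℕ → ℝ) (κ m n : ℕ) (s : ℝ) (x y : ℕ → A) : ℝ :=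
  if s ≤ (G K g κ x y m n).toReal then 1 else 0

variable {A : Type*} {K : A → A → ℝ} {g : ℕ → ℝ} {κ m n : ℕ} {s : ℝ}

lemma largeG_nonneg (x y : ℕ → A) : 0 ≤ largeG K g κ m n s x y := by
  unfold largeG; split_ifs <;> norm_num

lemma isLocal_largeG (hg0 : g 0 = 0) (hκ : 1 ≤ κ) (hm : κ ≤ m) (hn : κ ≤ n) (s : ℝ) :
    IsLocal m n (largeG K g κ m n s) :=
  isLocal_G hg0 hκ hm hn fun r => if s ≤ r then (1 : ℝ) else 0

lemma largeG_mul_le (hg0 : g 0 = 0) {κ₁ κ₂ m₁ n₁ m₂ n₂ : ℕ} (hκ₁ : 1 ≤ κ₁) (hκ₂ : 1 ≤ κ₂)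
    (hm₁ : κ₁ ≤ m₁) (hn₁ : κ₁ ≤ n₁) (hm₂ : κ₂ ≤ m₂) (hn₂ : κ₂ ≤ n₂) (s₁ s₂ : ℝ) (x y : ℕ → A) :
    largeG K g κ₁ m₁ n₁ s₁ x y *
        largeG K g κ₂ m₂ n₂ s₂ (fun i => x (m₁ + i)) (fun j => y (n₁ + j)) ≤
      largeG K g (κ₁ + κ₂) (m₁ + m₂) (n₁ + n₂) (s₁ + s₂) x y := by
  have h := G_add_le (K := K) (x := x) (y := y) hg0 hκ₁ hκ₂ hm₁ hn₁ hm₂ hn₂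
  unfold largeG
  split_ifs with h1 h2 h3 <;> norm_num
  linarith

variable [Fintype A] [MeasurableSpace A] [MeasurableSingletonClass A]
  {Ω : Type*} [MeasurableSpace Ω] {P : Measure Ω} [IsProbabilityMeasure P] {μ : Measure A}
  {X Y : ℕ → Ω → A} {M θ : ℝ}

lemma IsLetterModel.integrable_largeG (h : IsLetterModel P μ X Y) (hs : IsScoring K g M)
    (hκ : 1 ≤ κ) (hm : κ ≤ m) (hn : κ ≤ n) (s : ℝ) :
    Integrable (fun ω => largeG K g κ m n s (fun t => X t ω) (fun t => Y t ω)) P := by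
  simpa using h.integrable_local (isLocal_largeG (K := K) hs.zero hκ hm hn s) 0 0

/-- Exponential tails bound the exponential moments of smaller order. -/
lemma IsLetterModel.expMoment_le_of_tail (h : IsLetterModel P μ X Y) (hs : IsScoring K g M)
    (hκ : 1 ≤ κ) (hm : κ ≤ m) (hn : κ ≤ n) {b : ℝ} (hb : 0 ≤ b) (hbθ : b < θ)
    (htail : ∀ s : ℝ, 0 < s →
      ∫ ω, largeG K g κ m n s (fun t => X t ω) (fun t => Y t ω) ∂P ≤ Real.exp (-(θ * s))) :
    expMoment P X Y K g κ m n b ≤ Real.exp b * ∑' j : ℕ, Real.exp (b - θ) ^ j := by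
  have hgeo : Summable fun j : ℕ => Real.exp (b - θ) ^ j :=
    summable_geometric_of_lt_one (Real.exp_pos _).le (Real.exp_lt_one_iff.2 (by linarith))
  let J := ⌊(κ : ℝ) * M⌋₊
  -- The index `j` is the natural floor of the score; the constant at `j = 0` also covers negative
  -- scores, whose floor is `0`.
  let F : ℕ → Ω → ℝ := fun j ω => if j = 0 then 1 else
    largeG K g κ m n j (fun t => X t ω) (fun t => Y t ω)
  have hF0 : ∀ j ω, 0 ≤ F j ω := fun j ω => by
    simp only [F]; split_ifs
    exacts [zero_le_one, largeG_nonneg _ _]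
  have hFint : ∀ j, Integrable (F j) P := fun j => by
    rcases Nat.eq_zero_or_pos j with rfl | hj
    · simp [F]
    · simpa [F, hj.ne'] using h.integrable_largeG hs hκ hm hn j
  have hFle : ∀ j, ∫ ω, F j ω ∂P ≤ Real.exp (-(θ * j)) := fun j => by
    rcases Nat.eq_zero_or_pos j with rfl | hj
    · simp [F]
    · simpa [F, hj.ne'] using htail j (by exact_mod_cast hj)
  have hpt : ∀ ω, Real.exp (b * (G K g κ (fun i => X i ω) (fun j => Y j ω) m n).toReal) ≤
      ∑ j ∈ Finset.range (J + 1), Real.exp (b * (j + 1)) * F j ω := by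
    intro ω
    have hG := G_le (x := fun i => X i ω) (y := fun j => Y j ω) hs.zero hs.mono hs.sub hs.le
      hκ hm hn
    set r := (G K g κ (fun i => X i ω) (fun j => Y j ω) m n).toReal with hr
    have hrM : r ≤ κ * M := by linarith [hs.nonneg (m - κ), hs.nonneg (n - κ)]
    have hj : ⌊r⌋₊ ∈ Finset.range (J + 1) :=
      Finset.mem_range.2 (Nat.lt_succ_of_le (Nat.floor_le_floor hrM))
    have hF : F ⌊r⌋₊ ω = 1 := by
      simp only [F]
      split_ifs with h0
      · rfl
      · have : 0 ≤ r := by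
          by_contra hneg
          exact h0 (Nat.floor_of_nonpos (by linarith))
        exact if_pos (Nat.floor_le this)
    refine le_trans ?_ (Finset.single_le_sum
      (fun j _ => mul_nonneg (Real.exp_pos _).le (hF0 j ω)) hj)
    rw [hF, mul_one]
    exact Real.exp_le_exp.2 (mul_le_mul_of_nonneg_left (Nat.lt_floor_add_one r).le hb)
  calc expMoment P X Y K g κ m n b
      ≤ ∫ ω, ∑ j ∈ Finset.range (J + 1), Real.exp (b * (j + 1)) * F j ω ∂P :=
        integral_mono (h.integrable_exp hs hκ hm hn _)
          (integrable_finsetSum _ fun j _ => (hFint j).const_mul _) hpt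
    _ = ∑ j ∈ Finset.range (J + 1), Real.exp (b * (j + 1)) * ∫ ω, F j ω ∂P := by
        rw [integral_finsetSum _ fun j _ => (hFint j).const_mul _]
        simp only [integral_const_mul]
    _ ≤ ∑ j ∈ Finset.range (J + 1), Real.exp b * Real.exp (b - θ) ^ j := by
        refine Finset.sum_le_sum fun j _ => ?_
        refine (mul_le_mul_of_nonneg_left (hFle j) (Real.exp_pos _).le).trans (le_of_eq ?_)
        rw [← Real.exp_nat_mul, ← Real.exp_add, ← Real.exp_add]
        congr 1; ring
    _ ≤ _ := by
        rw [← Finset.mul_sum]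
        exact mul_le_mul_of_nonneg_left (hgeo.sum_le_tsum _ fun _ _ => by positivity)
          (Real.exp_pos _).le

/-- Where `ψ` is positive, large scores are not too rare. -/
lemma IsLetterModel.exists_largeG (h : IsLetterModel P μ X Y) (hs : IsScoring K g M)
    {θ' : ℝ} (hθ' : 0 < θ') (hψ : 0 < psi P X Y K g θ') (hθ : θ' < θ) :
    ∃ κ m n : ℕ, 1 ≤ κ ∧ κ ≤ m ∧ κ ≤ n ∧ ∃ s : ℝ, 0 < s ∧ Real.exp (-(θ * s)) ≤
      ∫ ω, largeG K g κ m n s (fun t => X t ω) (fun t => Y t ω) ∂P := by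
  by_contra hcon
  push Not at hcon
  -- If all tails were below `exp (-(θ s))`, the moments of order `θ' - a < θ` would be uniformly
  -- bounded. The remaining order `a` is paid by the deterministic bound, which makes the sum over
  -- lengths converge at the cost `exp (a M κ)`. Hence `ψ(θ') ≤ a M < ψ(θ')`.
  set a := min (θ' / 2) (psi P X Y K g θ' / (2 * M)) with ha
  have hM := hs.pos
  have ha0 : 0 < a := lt_min (by linarith) (by positivity)
  have haθ : a ≤ θ' / 2 := min_le_left _ _
  have haM : a * M < psi P X Y K g θ' := by
    have : a ≤ psi P X Y K g θ' / (2 * M) := min_le_right _ _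
    rw [le_div_iff₀ (by positivity)] at this
    linarith
  have hb0 : 0 ≤ θ' - a := by linarith
  have hbθ : θ' - a < θ := by linarith
  set C := Real.exp (θ' - a) * ∑' j : ℕ, Real.exp (θ' - a - θ) ^ j with hC
  have hC0 : 0 < C := by
    have hgeo : Summable fun j : ℕ => Real.exp (θ' - a - θ) ^ j :=
      summable_geometric_of_lt_one (Real.exp_pos _).le (Real.exp_lt_one_iff.2 (by linarith))
    exact mul_pos (Real.exp_pos _) (hgeo.tsum_pos (fun _ => by positivity) 0 (by positivity))
  have hsum := hs.summable_exp_prod ha0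
  have hle := h.psi_le_of_h_le hs hθ' (c := a * M) (C := C * ∑' r : ℕ × ℕ,
    Real.exp (-(a * g r.1)) * Real.exp (-(a * g r.2)))
    (mul_pos hC0 (hsum.tsum_pos (fun _ => by positivity) (0, 0) (by positivity))) fun κ hκ => ?_
  · linarith
  · have hterm : ∀ r : ℕ × ℕ, expMoment P X Y K g κ (κ + r.1) (κ + r.2) θ' ≤
        (C * Real.exp (a * M * κ)) * (Real.exp (-(a * g r.1)) * Real.exp (-(a * g r.2))) := by
      intro r
      have h1 := h.expMoment_add_le hs hκ ha0.le (θ' - a) r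
      rw [add_sub_cancel] at h1
      have h2 := h.expMoment_le_of_tail hs hκ (Nat.le_add_right κ r.1) (Nat.le_add_right κ r.2)
        hb0 hbθ fun s hs0 => (hcon κ _ _ hκ (Nat.le_add_right κ r.1)
          (Nat.le_add_right κ r.2) s hs0).le
      refine h1.trans ((mul_le_mul_of_nonneg_left h2 (by positivity)).trans (le_of_eq ?_))
      ring
    calc LocalAlignment.h P X Y K g κ θ'
        ≤ ∑' r : ℕ × ℕ, (C * Real.exp (a * M * κ)) *
          (Real.exp (-(a * g r.1)) * Real.exp (-(a * g r.2))) :=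
          (h.summable_expMoment hs hκ hθ').tsum_le_tsum hterm (hsum.mul_left _)
      _ = _ := by rw [tsum_mul_left]; ring

/-- If `k + 1` consecutive independent blocks each score at least `s`, their concatenation scores at
least the sum. -/
lemma IsLetterModel.pow_le_largeG (h : IsLetterModel P μ X Y) (hs : IsScoring K g M)
    (hκ : 1 ≤ κ) (hm : κ ≤ m) (hn : κ ≤ n) (s : ℝ) (k : ℕ) :
    (∫ ω, largeG K g κ m n s (fun t => X t ω) (fun t => Y t ω) ∂P) ^ (k + 1) ≤
      ∫ ω, largeG K g ((k + 1) * κ) ((k + 1) * m) ((k + 1) * n) ((k + 1 : ℕ) * s)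
        (fun t => X t ω) (fun t => Y t ω) ∂P := by
  induction k with
  | zero => simp
  | succ k ih =>
    have hκ' : 1 ≤ (k + 1) * κ := Nat.one_le_iff_ne_zero.2 (by positivity)
    have hm' : (k + 1) * κ ≤ (k + 1) * m := Nat.mul_le_mul_left _ hm
    have hn' : (k + 1) * κ ≤ (k + 1) * n := Nat.mul_le_mul_left _ hn
    have l1 := isLocal_largeG (K := K) hs.zero hκ' hm' hn' ((k + 1 : ℕ) * s)
    have l2 := isLocal_largeG (K := K) hs.zero hκ hm hn s
    have e : ∀ j : ℕ, (k + 1 + 1) * j = (k + 1) * j + j := fun j => by ring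
    have es : ((k + 1 + 1 : ℕ) : ℝ) * s = (k + 1 : ℕ) * s + s := by push_cast; ring
    rw [pow_succ, e, e, e, es]
    refine (mul_le_mul_of_nonneg_right ih
      (integral_nonneg fun _ => largeG_nonneg _ _)).trans ?_
    rw [← h.integral_mul l1 l2]
    refine integral_mono ?_ (h.integrable_largeG hs (by omega) (by omega) (by omega) _)
      fun ω => largeG_mul_le hs.zero hκ' hκ hm' hn' hm hn _ _ _ _
    have l12 : IsLocal ((k + 1) * m + m) ((k + 1) * n + n) fun x y =>
        largeG K g ((k + 1) * κ) ((k + 1) * m) ((k + 1) * n) ((k + 1 : ℕ) * s) x y *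
          largeG K g κ m n s (fun t => x ((k + 1) * m + t)) (fun t => y ((k + 1) * n + t)) := by
      intro x x' y y' hx hy
      have e1 := l1 (x := x) (x' := x') (y := y) (y' := y') (fun i hi => hx i (by omega))
        (fun i hi => hy i (by omega))
      have e2 := l2 (x := fun t => x ((k + 1) * m + t)) (x' := fun t => x' ((k + 1) * m + t))
        (y := fun t => y ((k + 1) * n + t)) (y' := fun t => y' ((k + 1) * n + t))
        (fun i hi => hx _ (by omega)) (fun i hi => hy _ (by omega))
      simp only [e1, e2]
    simpa using h.integrable_local l12 0 0

end LargeScores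

/-! ### Making a weighted bipartite relation nearly regular. -/

section Regularization

variable {U V : Type*} [Fintype U] [Fintype V]

open Classical in
/-- Some dyadic level set of a function with values in `[0, 1]` carries a fair share of its mean. -/
lemma exists_level {α : U → ℝ} (hα : ∀ x, 0 ≤ α x) (hα1 : ∑ x, α x = 1) {u : U → ℝ}
    (hu0 : ∀ x, 0 ≤ u x) (hu1 : ∀ x, u x ≤ 1) {J : ℕ}
    (hJq : (1 / 2 : ℝ) ^ J ≤ (∑ x, α x * u x) / 2) (hJ : 1 ≤ J) :
    ∃ a : ℝ, 0 < a ∧ (∑ x, α x * u x) / (2 * J) ≤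
      ∑ x, α x * (if a < u x ∧ u x ≤ 2 * a then u x else 0) := by
  set q := ∑ x, α x * u x with hq
  -- Values up to `(1 / 2) ^ J` contribute at most half of the mean, so one of the `J` dyadic levels
  -- carries at least `1 / J` of the other half.
  have hpt : ∀ x, u x ≤ (1 / 2 : ℝ) ^ J + ∑ j ∈ Finset.range J,
      (if (1 / 2 : ℝ) ^ (j + 1) < u x ∧ u x ≤ 2 * (1 / 2 : ℝ) ^ (j + 1) then u x else 0) := by
    intro x
    have hnn : ∀ j ∈ Finset.range J, (0 : ℝ) ≤
        (if (1 / 2 : ℝ) ^ (j + 1) < u x ∧ u x ≤ 2 * (1 / 2 : ℝ) ^ (j + 1) then u x else 0) :=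
      fun j _ => by split_ifs; exacts [hu0 x, le_rfl]
    by_cases hx : u x ≤ (1 / 2 : ℝ) ^ J
    · linarith [Finset.sum_nonneg hnn]
    · push Not at hx
      have hex : ∃ j, (1 / 2 : ℝ) ^ (j + 1) < u x := ⟨J, lt_trans (by
        rw [pow_succ]; linarith [show (0 : ℝ) < (1 / 2) ^ J by positivity]) hx⟩
      have hfind := Nat.find_spec hex
      have hlt : Nat.find hex < J := by
        have : Nat.find hex ≤ J - 1 := Nat.find_min' hex (by rwa [Nat.sub_add_cancel hJ])
        omega
      have hup : u x ≤ 2 * (1 / 2 : ℝ) ^ (Nat.find hex + 1) := by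
        rcases Nat.eq_zero_or_pos (Nat.find hex) with h0 | h0
        · rw [h0]; norm_num; exact hu1 x
        · have := Nat.find_min hex (Nat.sub_lt h0 one_pos)
          rw [show Nat.find hex - 1 + 1 = Nat.find hex from Nat.sub_add_cancel h0] at this
          push Not at this
          rw [pow_succ]; linarith
      have := Finset.single_le_sum hnn (Finset.mem_range.2 hlt)
      rw [if_pos ⟨hfind, hup⟩] at this
      linarith [show (0 : ℝ) < (1 / 2) ^ J by positivity]
  have hsum : q ≤ (1 / 2 : ℝ) ^ J + ∑ j ∈ Finset.range J, ∑ x, α x *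
      (if (1 / 2 : ℝ) ^ (j + 1) < u x ∧ u x ≤ 2 * (1 / 2 : ℝ) ^ (j + 1) then u x else 0) := by
    rw [Finset.sum_comm]
    simp only [← Finset.mul_sum]
    calc q ≤ ∑ x, α x * ((1 / 2 : ℝ) ^ J + ∑ j ∈ Finset.range J,
      (if (1 / 2 : ℝ) ^ (j + 1) < u x ∧ u x ≤ 2 * (1 / 2 : ℝ) ^ (j + 1) then u x else 0)) :=
          Finset.sum_le_sum fun x _ => mul_le_mul_of_nonneg_left (hpt x) (hα x)
      _ = _ := by simp only [mul_add, Finset.sum_add_distrib, ← Finset.sum_mul, hα1, one_mul]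
  have hJ0 : (0 : ℝ) < J := by exact_mod_cast hJ
  have hle : ∑ _j ∈ Finset.range J, q / (2 * J) ≤ ∑ j ∈ Finset.range J, ∑ x, α x *
      (if (1 / 2 : ℝ) ^ (j + 1) < u x ∧ u x ≤ 2 * (1 / 2 : ℝ) ^ (j + 1) then u x else 0) := by
    have : ∑ _j ∈ Finset.range J, q / (2 * J) = q / 2 := by
      rw [Finset.sum_const, Finset.card_range, nsmul_eq_mul]
      field_simp
    rw [this]
    linarith
  obtain ⟨j, -, hj⟩ := Finset.exists_le_of_sum_le
    (Finset.nonempty_range_iff.2 (by omega)) hle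
  exact ⟨(1 / 2) ^ (j + 1), by positivity, hj⟩

/-- The part of a relation between two level sets of its degrees is nearly regular. -/
lemma exists_regular {α : U → ℝ} {β : V → ℝ} (hα : ∀ x, 0 ≤ α x) (hα1 : ∑ x, α x = 1)
    (hβ : ∀ y, 0 ≤ β y) (hβ1 : ∑ y, β y = 1) {f : U → V → ℝ} (hf : ∀ x y, f x y = 0 ∨ f x y = 1)
    {J : ℕ} (hJ : 1 ≤ J) {q : ℝ} (hq : q = ∑ x, ∑ y, α x * β y * f x y)
    (hJq : (1 / 2 : ℝ) ^ J ≤ q / (4 * J)) :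
    ∃ f' : U → V → ℝ, (∀ x y, f' x y = 0 ∨ f' x y = 1) ∧ (∀ x y, f' x y ≤ f x y) ∧
      q / (4 * (J : ℝ) ^ 2) ≤ ∑ x, ∑ y, α x * β y * f' x y ∧
      (∑ x, α x * (∑ y, β y * f' x y) ^ 2) * (∑ y, β y * (∑ x, α x * f' x y) ^ 2) ≤
        16 * (J : ℝ) ^ 2 * (∑ x, ∑ y, α x * β y * f' x y) ^ 3 := by
  classical
  have hJ1 : (1 : ℝ) ≤ J := by exact_mod_cast hJ
  have hq0 : 0 < q := by
    have h1 : (0 : ℝ) < (1 / 2) ^ J := by positivity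
    have h2 : 0 < q / (4 * J) := h1.trans_le hJq
    exact (div_pos_iff_of_pos_right (by positivity)).1 h2
  have hf0 : ∀ x y, 0 ≤ f x y := fun x y => by rcases hf x y with h | h <;> simp [h]
  have hf1 : ∀ x y, f x y ≤ 1 := fun x y => by rcases hf x y with h | h <;> simp [h]
  let u : U → ℝ := fun x => ∑ y, β y * f x y
  have hu0 : ∀ x, 0 ≤ u x := fun x => Finset.sum_nonneg fun y _ => mul_nonneg (hβ y) (hf0 x y)
  have hu1 : ∀ x, u x ≤ 1 := fun x => by
    rw [← hβ1]
    exact Finset.sum_le_sum fun y _ => mul_le_of_le_one_right (hβ y) (hf1 x y)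
  have hqu : ∑ x, α x * u x = q := by
    simp only [hq, u, Finset.mul_sum, mul_assoc]
  obtain ⟨a, ha, hqa⟩ := exists_level hα hα1 hu0 hu1 (J := J)
    (by rw [hqu]; refine hJq.trans (div_le_div_of_nonneg_left hq0.le two_pos (by linarith))) hJ
  rw [hqu] at hqa
  -- Only rows of degree comparable to `a` are kept; then, for the new column degrees `v`, only
  -- columns of degree comparable to `b`.
  let f₁ : U → V → ℝ := fun x y => if a < u x ∧ u x ≤ 2 * a then f x y else 0
  have hf₁0 : ∀ x y, 0 ≤ f₁ x y := fun x y => by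
    simp only [f₁]; split_ifs; exacts [hf0 x y, le_rfl]
  have hf₁f : ∀ x y, f₁ x y ≤ f x y := fun x y => by
    simp only [f₁]; split_ifs; exacts [le_rfl, hf0 x y]
  let v : V → ℝ := fun y => ∑ x, α x * f₁ x y
  have hv0 : ∀ y, 0 ≤ v y := fun y => Finset.sum_nonneg fun x _ => mul_nonneg (hα x) (hf₁0 x y)
  have hv1 : ∀ y, v y ≤ 1 := fun y => by
    rw [← hα1]
    exact Finset.sum_le_sum fun x _ =>
      mul_le_of_le_one_right (hα x) ((hf₁f x y).trans (hf1 x y))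
  have hq₁ : ∑ y, β y * v y = ∑ x, α x * (if a < u x ∧ u x ≤ 2 * a then u x else 0) := by
    simp only [v, Finset.mul_sum]
    rw [Finset.sum_comm]
    refine Finset.sum_congr rfl fun x _ => ?_
    by_cases hx : a < u x ∧ u x ≤ 2 * a
    · simp only [f₁, if_pos hx, u, Finset.mul_sum]
      exact Finset.sum_congr rfl fun y _ => by ring
    · simp only [f₁, if_neg hx, mul_zero, Finset.sum_const_zero]
  rw [← hq₁] at hqa
  obtain ⟨b, hb, hqb⟩ := exists_level hβ hβ1 hv0 hv1 (J := J)
    (by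
      refine hJq.trans ?_
      calc q / (4 * J) = q / (2 * J) / 2 := by field_simp; norm_num
        _ ≤ _ := div_le_div_of_nonneg_right hqa two_pos.le) hJ
  let f₂ : U → V → ℝ := fun x y => if b < v y ∧ v y ≤ 2 * b then f₁ x y else 0
  have hf₂0 : ∀ x y, 0 ≤ f₂ x y := fun x y => by
    simp only [f₂]; split_ifs; exacts [hf₁0 x y, le_rfl]
  have hf₂f₁ : ∀ x y, f₂ x y ≤ f₁ x y := fun x y => by
    simp only [f₂]; split_ifs; exacts [le_rfl, hf₁0 x y]
  have hv₂ : ∀ y, ∑ x, α x * f₂ x y = if b < v y ∧ v y ≤ 2 * b then v y else 0 := fun y => by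
    by_cases hy : b < v y ∧ v y ≤ 2 * b
    · simp only [f₂, if_pos hy, v]
    · simp only [f₂, if_neg hy, mul_zero, Finset.sum_const_zero]
  have hu₂ : ∀ x, ∑ y, β y * f₂ x y ≤ 2 * a := fun x => by
    by_cases hx : a < u x ∧ u x ≤ 2 * a
    · refine le_trans (Finset.sum_le_sum fun y _ => mul_le_mul_of_nonneg_left
        ((hf₂f₁ x y).trans (hf₁f x y)) (hβ y)) hx.2
    · refine le_trans (Finset.sum_le_sum (g := fun _ => (0 : ℝ)) fun y _ => ?_) (by simp; linarith)
      have : f₂ x y = 0 := by simp only [f₂, f₁, if_neg hx, ite_self]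
      simp [this]
  have hu₂0 : ∀ x, 0 ≤ ∑ y, β y * f₂ x y := fun x =>
    Finset.sum_nonneg fun y _ => mul_nonneg (hβ y) (hf₂0 x y)
  set q₂ := ∑ x, ∑ y, α x * β y * f₂ x y with hq₂
  have hq₂u : q₂ = ∑ x, α x * ∑ y, β y * f₂ x y := by
    simp only [hq₂, Finset.mul_sum, mul_assoc]
  have hq₂v : q₂ = ∑ y, β y * (if b < v y ∧ v y ≤ 2 * b then v y else 0) := by
    rw [hq₂, Finset.sum_comm]
    simp only [← hv₂, Finset.mul_sum]
    exact Finset.sum_congr rfl fun y _ => Finset.sum_congr rfl fun x _ => by ring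
  rw [← hq₂v] at hqb
  have hqq₂ : q / (4 * (J : ℝ) ^ 2) ≤ q₂ := by
    refine le_trans ?_ hqb
    calc q / (4 * (J : ℝ) ^ 2) = q / (2 * J) / (2 * J) := by field_simp; norm_num
      _ ≤ _ := div_le_div_of_nonneg_right hqa (by positivity)
  have hq₂0 : 0 < q₂ := lt_of_lt_of_le (by positivity) hqq₂
  let α' : U → ℝ := fun x => if a < u x ∧ u x ≤ 2 * a then α x else 0
  let β' : V → ℝ := fun y => if b < v y ∧ v y ≤ 2 * b then β y else 0
  have hα'0 : ∀ x, 0 ≤ α' x := fun x => by simp only [α']; split_ifs; exacts [hα x, le_rfl]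
  have hβ'0 : ∀ y, 0 ≤ β' y := fun y => by simp only [β']; split_ifs; exacts [hβ y, le_rfl]
  have hA : a * ∑ x, α' x ≤ q := by
    rw [← hqu, Finset.mul_sum]
    refine Finset.sum_le_sum fun x _ => ?_
    simp only [α']
    split_ifs with hx
    · rw [mul_comm]; exact mul_le_mul_of_nonneg_left hx.1.le (hα x)
    · rw [mul_zero]; exact mul_nonneg (hα x) (hu0 x)
  have hB : b * ∑ y, β' y ≤ q₂ := by
    rw [hq₂v, Finset.mul_sum]
    refine Finset.sum_le_sum fun y _ => ?_
    simp only [β']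
    split_ifs with hy
    · rw [mul_comm]; exact mul_le_mul_of_nonneg_left hy.1.le (hβ y)
    · simp
  have hAB : q₂ ≤ (∑ x, α' x) * ∑ y, β' y := by
    rw [hq₂, Finset.sum_mul_sum]
    refine Finset.sum_le_sum fun x _ => Finset.sum_le_sum fun y _ => ?_
    simp only [α', β', f₂, f₁]
    split_ifs
    · exact mul_le_of_le_one_right (mul_nonneg (hα x) (hβ y)) (hf1 x y)
    all_goals simp
  -- The kept rows weigh at most `q / a` and the kept columns at most `q₂ / b`; their rectangle
  -- contains the remaining relation of weight `q₂`.
  have hab : a * b ≤ q := by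
    have h1 : a * b * q₂ ≤ q * q₂ := by
      calc a * b * q₂ ≤ a * b * ((∑ x, α' x) * ∑ y, β' y) :=
            mul_le_mul_of_nonneg_left hAB (by positivity)
        _ = (a * ∑ x, α' x) * (b * ∑ y, β' y) := by ring
        _ ≤ q * q₂ := mul_le_mul hA hB
            (mul_nonneg hb.le (Finset.sum_nonneg fun y _ => hβ'0 y)) hq0.le
    exact le_of_mul_le_mul_right h1 hq₂0
  have hq4 : q ≤ 4 * (J : ℝ) ^ 2 * q₂ := by
    rwa [div_le_iff₀ (by positivity), mul_comm] at hqq₂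
  have h1 : ∑ x, α x * (∑ y, β y * f₂ x y) ^ 2 ≤ 2 * a * q₂ := by
    rw [hq₂u, Finset.mul_sum]
    refine Finset.sum_le_sum fun x _ => ?_
    have := mul_le_mul_of_nonneg_right (hu₂ x) (hu₂0 x)
    have := mul_le_mul_of_nonneg_left this (hα x)
    linarith
  have h2 : ∑ y, β y * (∑ x, α x * f₂ x y) ^ 2 ≤ 2 * b * q₂ := by
    rw [hq₂v, Finset.mul_sum]
    refine Finset.sum_le_sum fun y _ => ?_
    rw [hv₂]
    split_ifs with hy
    · have := mul_le_mul_of_nonneg_right hy.2 (hv0 y)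
      have := mul_le_mul_of_nonneg_left this (hβ y)
      linarith
    · simp
  refine ⟨f₂, fun x y => ?_, fun x y => (hf₂f₁ x y).trans (hf₁f x y), hqq₂, ?_⟩
  · simp only [f₂, f₁]
    split_ifs
    exacts [hf x y, Or.inl rfl, Or.inl rfl]
  · refine (mul_le_mul h1 h2 (Finset.sum_nonneg fun y _ => mul_nonneg (hβ y) (sq_nonneg _))
      (by positivity)).trans ?_
    calc 2 * a * q₂ * (2 * b * q₂) = 4 * (a * b) * q₂ ^ 2 := by ring
      _ ≤ 4 * (4 * (J : ℝ) ^ 2 * q₂) * q₂ ^ 2 := mul_le_mul_of_nonneg_right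
          (mul_le_mul_of_nonneg_left (hab.trans hq4) (by norm_num)) (sq_nonneg _)
      _ = _ := by ring

end Regularization

/-! ### Second moment method for related pairs of independent blocks. -/

section SecondMoment

lemma integral_sub_mul_sub {Ω : Type*} [MeasurableSpace Ω] {P : Measure Ω}
    [IsProbabilityMeasure P] {a b : Ω → ℝ} {p : ℝ} (ha : Integrable a P) (hb : Integrable b P)
    (hab : Integrable (fun ω => a ω * b ω) P) (hap : ∫ ω, a ω ∂P = p) (hbp : ∫ ω, b ω ∂P = p) :
    ∫ ω, (a ω - p) * (b ω - p) ∂P = ∫ ω, a ω * b ω ∂P - p ^ 2 := by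
  have e : ∀ ω, (a ω - p) * (b ω - p) = a ω * b ω - (p * a ω + p * b ω - p ^ 2) :=
    fun ω => by ring
  have i1 : Integrable (fun ω => p * a ω + p * b ω) P := (ha.const_mul p).add (hb.const_mul p)
  have i2 : Integrable (fun ω => p * a ω + p * b ω - p ^ 2) P := i1.sub (integrable_const _)
  simp only [e]
  rw [integral_sub hab i2, integral_sub i1 (integrable_const _),
    integral_add (ha.const_mul p) (hb.const_mul p), integral_const_mul, integral_const_mul, hap,
    hbp, integral_const]
  simp
  ring

variable {A : Type*} [Fintype A] [MeasurableSpace A] [MeasurableSingletonClass A]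
  {Ω : Type*} [MeasurableSpace Ω] {P : Measure Ω} [IsProbabilityMeasure P] {μ : Measure A}
  {κ : Type*} {W : κ → Ω → A} {S : Type*} [Fintype S] [DecidableEq S]

/-- The second moment bound for the pairs of related blocks. -/
lemma measureReal_no_related_le (hW : ∀ k, Measurable (W k)) (hμ : ∀ k, P.map (W k) = μ)
    (hind : iIndepFun W P) {B : ℕ} {E : (Fin B ⊕ Fin B) × S → κ} (hE : E.Injective)
    {F : (S → A) → (S → A) → ℝ} (hF : ∀ s t, F s t = 0 ∨ F s t = 1)
    (hsymm : ∀ s t, F s t = F t s) {p r : ℝ}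
    (hp : p = ∑ s, ∑ t, wordWeight (fun a => μ.real {a}) s *
      wordWeight (fun a => μ.real {a}) t * F s t)
    (hr : r = ∑ s, wordWeight (fun a => μ.real {a}) s *
      (∑ t, wordWeight (fun a => μ.real {a}) t * F s t) ^ 2) (hp0 : 0 < p) (hB : 1 ≤ B) :
    P.real {ω | ∀ I J, F (fun s => W (E (Sum.inl I, s)) ω) (fun s => W (E (Sum.inr J, s)) ω) = 0}
      ≤ 1 / ((B : ℝ) ^ 2 * p) + 2 * r / (B * p ^ 2) := by
  have hd : ∀ d, (fun s => E (d, s)).Injective := fun d a b e => (Prod.ext_iff.1 (hE e)).2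
  have hne : ∀ {d d' : Fin B ⊕ Fin B}, d ≠ d' → ∀ a b, E (d, a) ≠ E (d', b) :=
    fun h a b e => h (Prod.ext_iff.1 (hE e)).1
  have hinj : ∀ {d d' : Fin B ⊕ Fin B}, d ≠ d' →
      (Sum.elim (fun s => E (d, s)) fun s => E (d', s)).Injective := fun {d d'} h =>
    (hd d).sumElim (hd d') (hne h)
  have hinj3 : ∀ {d d' d'' : Fin B ⊕ Fin B}, d ≠ d' → d ≠ d'' → d' ≠ d'' →
      (Sum.elim (fun s => E (d, s))
        (Sum.elim (fun s => E (d', s)) fun s => E (d'', s))).Injective := by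
    intro d d' d'' h1 h2 h3
    refine (hd d).sumElim (hinj h3) ?_
    rintro a (b | b)
    exacts [hne h1 a b, hne h2 a b]
  have hinj4 : ∀ {I I' J J' : Fin B}, I ≠ I' → J ≠ J' →
      (Sum.elim (Sum.elim (fun s => E (Sum.inl I, s)) fun s => E (Sum.inr J, s))
        (Sum.elim (fun s => E (Sum.inl I', s)) fun s => E (Sum.inr J', s))).Injective := by
    intro I I' J J' h1 h2
    refine (hinj Sum.inl_ne_inr).sumElim (hinj Sum.inl_ne_inr) ?_
    rintro (a | a) (b | b)
    exacts [hne (Sum.inl_injective.ne h1) a b, hne Sum.inl_ne_inr a b, hne Sum.inr_ne_inl a b,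
      hne (Sum.inr_injective.ne h2) a b]
  let f : Fin B → Fin B → Ω → ℝ := fun I J ω =>
    F (fun s => W (E (Sum.inl I, s)) ω) (fun s => W (E (Sum.inr J, s)) ω)
  have hf01 : ∀ I J ω, f I J ω = 0 ∨ f I J ω = 1 := fun I J ω => hF _ _
  have hint : ∀ I J, Integrable (f I J) P := fun I J =>
    integrable_word hW (Sum.elim (fun s => E (Sum.inl I, s)) fun s => E (Sum.inr J, s))
      fun t => F (t ∘ Sum.inl) (t ∘ Sum.inr)
  have hmean : ∀ I J, ∫ ω, f I J ω ∂P = p := fun I J => by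
    rw [hp]
    exact integral_word_two hW hμ hind (hinj (by simp)) F
  have hintmul : ∀ I J I' J', Integrable (fun ω => f I J ω * f I' J' ω) P := by
    intro I J I' J'
    exact integrable_word hW
      (Sum.elim (Sum.elim (fun s => E (Sum.inl I, s)) fun s => E (Sum.inr J, s))
        (Sum.elim (fun s => E (Sum.inl I', s)) fun s => E (Sum.inr J', s)))
      fun t => F (t ∘ Sum.inl ∘ Sum.inl) (t ∘ Sum.inl ∘ Sum.inr) *
        F (t ∘ Sum.inr ∘ Sum.inl) (t ∘ Sum.inr ∘ Sum.inr)
  have h3 : ∀ {d d' d'' : Fin B ⊕ Fin B}, d ≠ d' → d ≠ d'' → d' ≠ d'' →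
      ∫ ω, F (fun s => W (E (d, s)) ω) (fun s => W (E (d', s)) ω) *
        F (fun s => W (E (d, s)) ω) (fun s => W (E (d'', s)) ω) ∂P = r := by
    intro d d' d'' h1 h2 h3
    have := integral_word_two hW hμ hind (hinj3 h1 h2 h3)
      fun s t => F s (t ∘ Sum.inl) * F s (t ∘ Sum.inr)
    refine Eq.trans this ?_
    rw [hr]
    refine Finset.sum_congr rfl fun s _ => ?_
    simp only [mul_assoc, ← Finset.mul_sum]
    congr 1
    rw [sum_sumArrow, sq, Finset.sum_mul_sum]
    refine Finset.sum_congr rfl fun t _ => Finset.sum_congr rfl fun t' _ => ?_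
    simp only [Sum.elim_comp_inl, Sum.elim_comp_inr]
    ring
  -- Pairs without a common block are uncorrelated. One common block gives at most `r`, the second
  -- moment of the degrees; for a common second block this uses the symmetry of `F`.
  have hcov : ∀ I J I' J', ∫ ω, (f I J ω - p) * (f I' J' ω - p) ∂P ≤
      (if I = I' ∧ J = J' then p else 0) + (if I = I' then r else 0) +
        (if J = J' then r else 0) := by
    intro I J I' J'
    have hr0 : 0 ≤ r := by
      rw [hr]
      exact Finset.sum_nonneg fun s _ => mul_nonneg
        (wordWeight_nonneg (fun _ => measureReal_nonneg) _) (sq_nonneg _)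
    have hexp : ∫ ω, (f I J ω - p) * (f I' J' ω - p) ∂P =
        ∫ ω, f I J ω * f I' J' ω ∂P - p ^ 2 :=
      integral_sub_mul_sub (hint I J) (hint I' J') (hintmul I J I' J') (hmean I J)
        (hmean I' J')
    rw [hexp]
    by_cases hI : I = I'
    · by_cases hJ : J = J'
      · subst hI hJ
        have e : ∀ ω, f I J ω * f I J ω = f I J ω := fun ω => by
          rcases hf01 I J ω with h | h <;> simp [h]
        simp only [e, hmean]
        simp
        nlinarith [sq_nonneg p]
      · subst hI
        have : ∫ ω, f I J ω * f I J' ω ∂P = r := h3 (by simp) (by simp) (by simpa using hJ)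
        rw [this]
        simp [hJ]
        positivity
    · by_cases hJ : J = J'
      · subst hJ
        have : ∫ ω, f I J ω * f I' J ω ∂P = r := by
          have := h3 (d := Sum.inr J) (d' := Sum.inl I) (d'' := Sum.inl I') (by simp) (by simp)
            (by simpa using hI)
          rw [← this]
          refine integral_congr_ae (Eventually.of_forall fun ω => ?_)
          simp only [f]
          rw [hsymm, hsymm (fun s => W (E (Sum.inl I', s)) ω)]
        rw [this]
        simp [hI]
        positivity
      · have : ∫ ω, f I J ω * f I' J' ω ∂P = p ^ 2 := by
          have := integral_word_mul hW hμ hind (hinj4 hI hJ)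
            (fun t => F (t ∘ Sum.inl) (t ∘ Sum.inr)) (fun t => F (t ∘ Sum.inl) (t ∘ Sum.inr))
          refine Eq.trans this ?_
          rw [sq]
          exact congrArg₂ _ (hmean I J) (hmean I' J')
        rw [this]
        simp [hI, hJ]
  let Z : Ω → ℝ := fun ω => ∑ I, ∑ J, (f I J ω - p)
  have hZsq : ∀ ω, Z ω ^ 2 = ∑ I, ∑ J, ∑ I', ∑ J', (f I J ω - p) * (f I' J' ω - p) := by
    intro ω
    simp only [Z, sq, Finset.sum_mul, Finset.mul_sum]
    exact Finset.sum_congr rfl fun _ _ => Finset.sum_congr rfl fun _ _ =>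
      Finset.sum_congr rfl fun _ _ => Finset.sum_congr rfl fun _ _ => mul_comm _ _
  have hint2 : ∀ I J I' J', Integrable (fun ω => (f I J ω - p) * (f I' J' ω - p)) P := by
    intro I J I' J'
    have e : ∀ ω, (f I J ω - p) * (f I' J' ω - p) =
          f I J ω * f I' J' ω - (p * f I J ω + p * f I' J' ω - p ^ 2) := fun ω => by ring
    simp only [e]
    exact (hintmul I J I' J').sub
        ((((hint I J).const_mul p).add ((hint I' J').const_mul p)).sub (integrable_const _))
  have hZint : Integrable (fun ω => Z ω ^ 2) P := by
    simp only [hZsq]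
    exact integrable_finsetSum _ fun I _ => integrable_finsetSum _ fun J _ =>
      integrable_finsetSum _ fun I' _ => integrable_finsetSum _ fun J' _ => hint2 I J I' J'
  have hZle : ∫ ω, Z ω ^ 2 ∂P ≤ (B : ℝ) ^ 2 * p + 2 * (B : ℝ) ^ 3 * r := by
    have e : ∫ ω, Z ω ^ 2 ∂P =
        ∑ I, ∑ J, ∑ I', ∑ J', ∫ ω, (f I J ω - p) * (f I' J' ω - p) ∂P := by
      simp only [hZsq]
      rw [integral_finsetSum _ fun I _ => integrable_finsetSum _ fun J _ =>
        integrable_finsetSum _ fun I' _ => integrable_finsetSum _ fun J' _ => hint2 I J I' J']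
      refine Finset.sum_congr rfl fun I _ => ?_
      rw [integral_finsetSum _ fun J _ =>
        integrable_finsetSum _ fun I' _ => integrable_finsetSum _ fun J' _ => hint2 I J I' J']
      refine Finset.sum_congr rfl fun J _ => ?_
      rw [integral_finsetSum _ fun I' _ => integrable_finsetSum _ fun J' _ => hint2 I J I' J']
      refine Finset.sum_congr rfl fun I' _ => ?_
      rw [integral_finsetSum _ fun J' _ => hint2 I J I' J']
    rw [e]
    refine (Finset.sum_le_sum fun I _ => Finset.sum_le_sum fun J _ => Finset.sum_le_sum
      fun I' _ => Finset.sum_le_sum fun J' _ => hcov I J I' J').trans (le_of_eq ?_)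
    simp only [Finset.sum_add_distrib, ite_and, Finset.sum_ite_eq, Finset.mem_univ, if_true,
      Finset.sum_const, Finset.card_univ, Fintype.card_fin, nsmul_eq_mul]
    simp
    ring
  -- With no related pair the centred sum equals `-(B ^ 2 * p)`, so Chebyshev's inequality applies.
  have hsub : {ω | ∀ I J, F (fun s => W (E (Sum.inl I, s)) ω)
      (fun s => W (E (Sum.inr J, s)) ω) = 0} ⊆ {ω | ((B : ℝ) ^ 2 * p) ^ 2 ≤ Z ω ^ 2} := by
    intro ω hω
    have : Z ω = -((B : ℝ) ^ 2 * p) := by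
      have e : ∀ I J, f I J ω = 0 := hω
      simp [Z, e]
      ring
    simp [this]
  have hmarkov := mul_meas_ge_le_integral_of_nonneg (μ := P) (f := fun ω => Z ω ^ 2)
    (Eventually.of_forall fun ω => sq_nonneg _) hZint (((B : ℝ) ^ 2 * p) ^ 2)
  have hB0 : (0 : ℝ) < B := by exact_mod_cast hB
  refine (measureReal_mono hsub).trans ?_
  rw [← le_div_iff₀' (by positivity)] at hmarkov
  refine hmarkov.trans ((div_le_div_of_nonneg_right hZle (by positivity)).trans (le_of_eq ?_))
  field_simp

end SecondMoment

/-! ### Crossed blocks and a lower bound for `H` in probability. -/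

section LowerBound

/-- The letters of the blocks of length `a + b`: block `I` of `x` is a word of length `a` followed
by a word of length `b`, block `J` of `y` a word of length `b` followed by a word of length `a`. -/
def blockPositions (a b : ℕ) {B : ℕ} : (Fin B ⊕ Fin B) × (Fin a ⊕ Fin b) → ℕ ⊕ ℕ
  | (Sum.inl I, Sum.inl t) => Sum.inl (I * (a + b) + t)
  | (Sum.inl I, Sum.inr t) => Sum.inl (I * (a + b) + a + t)
  | (Sum.inr J, Sum.inl t) => Sum.inr (J * (a + b) + b + t)
  | (Sum.inr J, Sum.inr t) => Sum.inr (J * (a + b) + t)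

lemma mul_add_injective {L I I' c c' : ℕ} (hc : c < L) (hc' : c' < L)
    (h : I * L + c = I' * L + c') : I = I' ∧ c = c' := by
  have h1 : I = I' := by
    have e := congrArg (· / L) h
    simpa [Nat.add_div_of_dvd_right, Nat.div_eq_of_lt hc, Nat.div_eq_of_lt hc',
      Nat.mul_div_cancel _ (Nat.zero_lt_of_lt hc)] using e
  subst h1
  exact ⟨rfl, by omega⟩

lemma blockPositions_injective (a b : ℕ) {B : ℕ} :
    (blockPositions a b (B := B)).Injective := by
  rintro ⟨I | I, t | t⟩ ⟨I' | I', t' | t'⟩ h <;>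
    simp only [blockPositions, Sum.inl.injEq, Sum.inr.injEq, reduceCtorEq, add_assoc] at h <;>
    have ht := t.isLt <;> have ht' := t'.isLt <;>
    obtain ⟨h1, h2⟩ := mul_add_injective (by omega) (by omega) h <;>
    first
      | (have h3 : t = t' := Fin.ext (by omega)
         rw [Fin.ext h1, h3])
      | omega

variable {A : Type*} {K : A → A → ℝ} {g : ℕ → ℝ} {x y : ℕ → A}

lemma H_mono {N N' : ℕ} (h : N ≤ N') : H K g x y N N ≤ H K g x y N' N' := by
  refine iSup_mono fun z => ?_
  by_cases hf : z.Fits N N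
  · have hf' : z.Fits N' N' := ⟨hf.1.trans_le h, hf.2.trans_le h⟩
    rw [localScore_of_fits hf, localScore_of_fits hf']
  · rw [localScore_of_not_fits hf]
    exact bot_le

variable [Fintype A] [MeasurableSpace A] [MeasurableSingletonClass A]
  {Ω : Type*} [MeasurableSpace Ω] {P : Measure Ω} [IsProbabilityMeasure P] {μ : Measure A}
  {X Y : ℕ → Ω → A} {M θ : ℝ}

lemma IsLetterModel.sum_letters (h : IsLetterModel P μ X Y) : ∑ a, μ.real {a} = 1 := by
  have : IsProbabilityMeasure μ := by
    rw [← h.law_left 0]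
    exact Measure.isProbabilityMeasure_map (h.measurable_left 0).aemeasurable
  simp [sum_measureReal_singleton]

/-- Among `B` blocks of each sequence there is probably a pair with two large scores. -/
lemma IsLetterModel.H_lt_le (h : IsLetterModel P μ X Y) (hs : IsScoring K g M) {κ a b : ℕ}
    (hκ : 1 ≤ κ) (ha : κ ≤ a) (hb : κ ≤ b) {s q : ℝ}
    (hq : q = ∫ ω, largeG K g κ a b s (fun t => X t ω) (fun t => Y t ω) ∂P) {J B : ℕ}
    (hJ : 1 ≤ J) (hJq : (1 / 2 : ℝ) ^ J ≤ q / (4 * J)) (hB : 1 ≤ B) :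
    P.real {ω | H K g (fun i => X i ω) (fun j => Y j ω) (B * (a + b)) (B * (a + b)) <
        ((2 * s : ℝ) : EReal)} ≤
      (4 * (J : ℝ) ^ 2 / (B * q)) ^ 2 + 32 * (J : ℝ) ^ 2 * (4 * (J : ℝ) ^ 2 / (B * q)) := by
  obtain ⟨c⟩ := nonempty_letters P X
  set w : A → ℝ := fun a => μ.real {a} with hw
  have hw0 : ∀ a, 0 ≤ w a := fun _ => measureReal_nonneg
  have hloc := isLocal_largeG (K := K) hs.zero hκ ha hb s
  let f : (Fin a → A) → (Fin b → A) → ℝ := fun u v =>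
    largeG K g κ a b s (extendWord c u) (extendWord c v)
  have hf : ∀ u v, f u v = 0 ∨ f u v = 1 := fun u v => by
    simp only [f, largeG]; split_ifs <;> simp
  have hqf : q = ∑ u, ∑ v, wordWeight w u * wordWeight w v * f u v := by
    have h0 := fun ω => hloc.eq_onWords (X := X) (Y := Y) c 0 0 ω
    simp only [zero_add] at h0
    rw [hq]
    simp only [h0]
    rw [integral_word h.measurable h.law h.indep (positions_injective _ _ _ _), sum_sumArrow]
    rfl
  have hJ1 : (1 : ℝ) ≤ J := by exact_mod_cast hJ
  have hB1 : (1 : ℝ) ≤ B := by exact_mod_cast hB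
  have hq0 : 0 < q := by
    have h1 : (0 : ℝ) < (1 / 2) ^ J := by positivity
    exact (div_pos_iff_of_pos_right (by positivity)).1 (h1.trans_le hJq)
  obtain ⟨f', hf', hf'f, hq', hreg⟩ := exists_regular (wordWeight_nonneg hw0)
    (sum_wordWeight h.sum_letters) (wordWeight_nonneg hw0) (sum_wordWeight h.sum_letters) hf hJ
    hqf hJq
  set q' := ∑ u, ∑ v, wordWeight w u * wordWeight w v * f' u v with hq'def
  have hq'0 : 0 < q' := lt_of_lt_of_le (by positivity) hq'
  -- The crossing makes the relation symmetric and its degree the product of a row degree and a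
  -- column degree of `f'`. Its second moment is thus the product controlled by `exists_regular`,
  -- though neither factor alone need be well bounded.
  let F : (Fin a ⊕ Fin b → A) → (Fin a ⊕ Fin b → A) → ℝ := fun t t' =>
    f' (t ∘ Sum.inl) (t' ∘ Sum.inr) * f' (t' ∘ Sum.inl) (t ∘ Sum.inr)
  have hF : ∀ t t', F t t' = 0 ∨ F t t' = 1 := fun t t' => by
    rcases hf' (t ∘ Sum.inl) (t' ∘ Sum.inr) with h1 | h1 <;>
      rcases hf' (t' ∘ Sum.inl) (t ∘ Sum.inr) with h2 | h2 <;> simp [F, h1, h2]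
  let uu : (Fin a → A) → ℝ := fun u => ∑ v, wordWeight w v * f' u v
  let vv : (Fin b → A) → ℝ := fun v => ∑ u, wordWeight w u * f' u v
  have hinner : ∀ t, ∑ t', wordWeight w t' * F t t' = uu (t ∘ Sum.inl) * vv (t ∘ Sum.inr) := by
    intro t
    rw [sum_sumArrow, mul_comm, Finset.sum_mul_sum]
    refine Finset.sum_congr rfl fun u _ => Finset.sum_congr rfl fun v _ => ?_
    simp only [F, Sum.elim_comp_inl, Sum.elim_comp_inr]
    ring
  have hp : ∑ t, ∑ t', wordWeight w t * wordWeight w t' * F t t' = q' ^ 2 := by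
    have e1 : q' = ∑ u, wordWeight w u * uu u := by
      simp only [hq'def, uu, Finset.mul_sum, mul_assoc]
    have e2 : q' = ∑ v, wordWeight w v * vv v := by
      rw [hq'def, Finset.sum_comm]
      simp only [vv, Finset.mul_sum]
      exact Finset.sum_congr rfl fun v _ => Finset.sum_congr rfl fun u _ => by ring
    simp only [mul_assoc, ← Finset.mul_sum, hinner]
    rw [sum_sumArrow, sq]
    nth_rewrite 1 [e1]
    rw [e2, Finset.sum_mul_sum]
    refine Finset.sum_congr rfl fun u _ => Finset.sum_congr rfl fun v _ => ?_
    simp only [Sum.elim_comp_inl, Sum.elim_comp_inr]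
    ring
  have hr : ∑ t, wordWeight w t * (∑ t', wordWeight w t' * F t t') ^ 2 ≤
      16 * (J : ℝ) ^ 2 * q' ^ 3 := by
    refine le_trans (le_of_eq ?_) hreg
    simp only [hinner]
    rw [sum_sumArrow, Finset.sum_mul_sum]
    refine Finset.sum_congr rfl fun u _ => Finset.sum_congr rfl fun v _ => ?_
    simp only [Sum.elim_comp_inl, Sum.elim_comp_inr, uu, vv]
    ring
  have hmain := measureReal_no_related_le h.measurable h.law h.indep
    (blockPositions_injective a b (B := B)) hF (fun t t' => mul_comm _ _) rfl rfl
    (by rw [hp]; positivity) hB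
  rw [hp] at hmain
  have hsub : {ω | H K g (fun i => X i ω) (fun j => Y j ω) (B * (a + b)) (B * (a + b)) <
      ((2 * s : ℝ) : EReal)} ⊆ {ω | ∀ I J : Fin B,
        F (fun k => Sum.elim X Y (blockPositions a b (Sum.inl I, k)) ω)
          (fun k => Sum.elim X Y (blockPositions a b (Sum.inr J, k)) ω) = 0} := by
    intro ω hω I J
    by_contra hne
    refine absurd (show H K g (fun i => X i ω) (fun j => Y j ω) (B * (a + b)) (B * (a + b)) <
      ((2 * s : ℝ) : EReal) from hω) (not_lt.2 ?_)
    have hone : ∀ u v, f' u v ≠ 0 → s ≤ (G K g κ (extendWord c u) (extendWord c v) a b).toReal := by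
      intro u v huv
      have h1 : f' u v = 1 := (hf' u v).resolve_left huv
      have h2 := hf'f u v
      by_contra hlt
      have : f u v = 0 := if_neg hlt
      linarith
    have h1 := hone _ _ (left_ne_zero_of_mul hne)
    have h2 := hone _ _ (right_ne_zero_of_mul hne)
    replace h1 : s ≤ (G K g κ (fun t => X (I * (a + b) + t) ω)
        (fun t => Y (J * (a + b) + t) ω) a b).toReal :=
      h1.trans_eq (G_congr hs.zero hκ ha hb (fun i hi => extendWord_of_lt c _ hi)
        fun j hj => extendWord_of_lt c _ hj)
    replace h2 : s ≤ (G K g κ (fun t => Y (J * (a + b) + b + t) ω)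
        (fun t => X (I * (a + b) + a + t) ω) a b).toReal :=
      h2.trans_eq (G_congr hs.zero hκ ha hb (fun i hi => extendWord_of_lt c _ hi)
        fun j hj => extendWord_of_lt c _ hj)
    -- The second match has the sequences in exchanged roles; the symmetry of `K` turns it back, so
    -- that it can follow the first one.
    rw [← G_swap hs.zero hs.symm hκ ha hb] at h2
    have hadd := G_add_le (K := K) (x := fun t => X (I * (a + b) + t) ω)
      (y := fun t => Y (J * (a + b) + t) ω) hs.zero hκ hκ ha hb hb ha
    simp only [← add_assoc] at hadd
    have hle : ∀ i : Fin B, (i : ℕ) * (a + b) + (a + b) ≤ B * (a + b) := fun i => by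
      rw [← Nat.succ_mul]
      exact Nat.mul_le_mul_right _ i.isLt
    refine le_trans (EReal.coe_le_coe_iff.2 ?_) (G_le_H hs.zero hs.nonneg
      (κ := κ + κ) (i := I * (a + b)) (j := J * (a + b)) (m := a + b) (n := b + a) (by omega)
      (by omega) (by omega) (hle I) (by rw [add_comm b a]; exact hle J))
    linarith
  refine (measureReal_mono hsub).trans (hmain.trans ?_)
  have hq'q : 1 / (B * q') ≤ 4 * (J : ℝ) ^ 2 / (B * q) := by
    rw [div_le_iff₀ (by positivity)] at hq'
    rw [div_le_div_iff₀ (by positivity) (by positivity)]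
    nlinarith
  -- With mean `q' ^ 2` and second moment of order `q' ^ 3`, both terms depend on `B * q'` only, up
  -- to powers of `J`.
  have e1 : 1 / ((B : ℝ) ^ 2 * q' ^ 2) = (1 / (B * q')) ^ 2 := by
    field_simp
  have e2 : 2 * (16 * (J : ℝ) ^ 2 * q' ^ 3) / (B * (q' ^ 2) ^ 2) =
      32 * (J : ℝ) ^ 2 * (1 / (B * q')) := by
    field_simp; norm_num
  rw [e1]
  refine add_le_add (pow_le_pow_left₀ (by positivity) hq'q 2) ?_
  refine (div_le_div_of_nonneg_right (mul_le_mul_of_nonneg_left hr two_pos.le)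
    (by positivity)).trans ?_
  rw [e2]
  exact mul_le_mul_of_nonneg_left hq'q (by positivity)

end LowerBound

/-! ### The almost sure growth of `H` and the strong law for the number of matches. -/

section StrongLaw

lemma tendsto_mul_exp_neg {ε : ℝ} (hε : 0 < ε) (C : ℝ) :
    Tendsto (fun k : ℕ => C * (k * Real.exp (-ε * k))) atTop (𝓝 0) := by
  have := (Real.summable_pow_mul_exp_neg_nat_mul 1 hε).tendsto_atTop_zero.const_mul C
  simpa using this

variable {A : Type*} [Fintype A] [MeasurableSpace A] [MeasurableSingletonClass A]
  {Ω : Type*} [MeasurableSpace Ω] {P : Measure Ω} [IsProbabilityMeasure P] {μ : Measure A}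
  {X Y : ℕ → Ω → A} {K : A → A → ℝ} {g : ℕ → ℝ} {M θ : ℝ}

/-- Almost surely, `H` eventually exceeds every multiple of `log n` below `2 / θ`, if `ψ` is positive
at some point below `θ`. -/
lemma IsLetterModel.ae_eventually_le_H (h : IsLetterModel P μ X Y) (hs : IsScoring K g M)
    {θ' : ℝ} (hθ' : 0 < θ') (hψ : 0 < psi P X Y K g θ') (hθ : θ' < θ) {c : ℝ} (hc : 0 < c)
    (hcθ : c * θ < 2) :
    ∀ᵐ ω ∂P, ∀ᶠ n : ℕ in atTop, ((c * Real.log n : ℝ) : EReal) ≤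
      H K g (fun i => X i ω) (fun j => Y j ω) n n := by
  obtain ⟨κ, m, n, hκ, hm, hn, s, hs0, hq1⟩ := h.exists_largeG hs hθ' hψ hθ
  have hθ0 : 0 < θ := hθ'.trans hθ
  -- This leaves `c (θ s + 2 ε) < 2 s`: one `ε` goes into the number of blocks, the other absorbs
  -- the polynomial block length.
  set ε := (2 * s - c * (θ * s)) / (4 * c) with hεdef
  have hε : 0 < ε := by
    have : 0 < s * (2 - c * θ) := mul_pos hs0 (by linarith)
    exact div_pos (by linarith) (by linarith)
  have hcε : c * (2 * ε) < 2 * s - c * (θ * s) := by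
    have e : c * (2 * ε) = (2 * s - c * (θ * s)) / 2 := by
      rw [hεdef]; field_simp; ring
    have : 0 < s * (2 - c * θ) := mul_pos hs0 (by linarith)
    rw [e]; linarith
  have hlog2 : 0 < Real.log 2 := Real.log_pos one_lt_two
  -- With `J₀ k` dyadic levels, `2 ^ (-J₀ k)` is exponentially smaller than the lower bound `exp
  -- (-(θ s k))` for `q k`.
  obtain ⟨J₀, hJ₀⟩ := exists_nat_gt (θ * s / Real.log 2)
  rw [div_lt_iff₀ hlog2] at hJ₀
  have hθs : 0 < θ * s := mul_pos hθ0 hs0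
  have hJ₀pos : 1 ≤ J₀ := by
    rcases Nat.eq_zero_or_pos J₀ with h0 | h0
    · rw [h0] at hJ₀; simp at hJ₀; linarith
    · exact h0
  have hJ₀r : (1 : ℝ) ≤ J₀ := by exact_mod_cast hJ₀pos
  let q : ℕ → ℝ := fun k => ∫ ω, largeG K g (k * κ) (k * m) (k * n) (k * s)
    (fun t => X t ω) (fun t => Y t ω) ∂P
  have hq : ∀ k : ℕ, 1 ≤ k → Real.exp (-(θ * s * k)) ≤ q k := by
    intro k hk
    obtain ⟨j, rfl⟩ : ∃ j, k = j + 1 := ⟨k - 1, by omega⟩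
    refine le_trans ?_ (h.pow_le_largeG hs hκ hm hn s j)
    refine le_trans (le_of_eq ?_) (pow_le_pow_left₀ (Real.exp_pos _).le hq1 (j + 1))
    rw [← Real.exp_nat_mul]
    congr 1; ring
  -- Slightly more than `1 / q k`, so that `B k * q k ≥ exp (ε k)` and the failure probabilities are
  -- summable.
  let B : ℕ → ℕ := fun k => ⌈Real.exp ((θ * s + ε) * k)⌉₊
  have hB : ∀ k : ℕ, Real.exp ((θ * s + ε) * k) ≤ B k := fun k => Nat.le_ceil _
  have hbc := ae_eventually_notMem_of_summable (P := P)
    (s := fun k => {ω | H K g (fun i => X i ω) (fun j => Y j ω) (B k * (k * m + k * n))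
      (B k * (k * m + k * n)) < ((2 * (k * s) : ℝ) : EReal)})
    (b := fun k => 144 * (J₀ : ℝ) ^ 4 * ((k : ℝ) ^ 4 * Real.exp (-ε * k)))
    ((Real.summable_pow_mul_exp_neg_nat_mul 4 hε).mul_left _) ?_
  · have hN := (tendsto_mul_exp_neg hε (2 * (m + n))).eventually_le_const one_pos
    filter_upwards [hbc] with ω hω
    set γ := θ * s + 2 * ε with hγ
    have hγ0 : 0 < γ := by linarith
    have hlogn : Tendsto (fun n : ℕ => Real.log n) atTop atTop :=
      Real.tendsto_log_atTop.comp tendsto_natCast_atTop_atTop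
    have hk : Tendsto (fun n : ℕ => ⌊Real.log n / γ⌋₊) atTop atTop :=
      tendsto_nat_floor_atTop.comp (hlogn.atTop_div_const hγ0)
    have hcγ : 0 < 2 * s / γ - c := by
      rw [sub_pos, lt_div_iff₀ hγ0, hγ]; linarith
    filter_upwards [hk.eventually hω, hk.eventually hN,
      hlogn.eventually_ge_atTop (2 * s / (2 * s / γ - c)), eventually_ge_atTop 1]
      with n' h1 h2 h3 h4
    have hn0 : (0 : ℝ) < n' := by exact_mod_cast h4
    -- Nearly the largest `k` for which all blocks fit into `n'` letters, as their total length is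
    -- eventually at most `exp (γ k)`.
    set k := ⌊Real.log n' / γ⌋₊ with hkdef
    have hkle : γ * k ≤ Real.log n' := by
      rw [mul_comm, ← le_div_iff₀ hγ0]
      exact Nat.floor_le (div_nonneg (Real.log_nonneg (by exact_mod_cast h4)) hγ0.le)
    have hkge : Real.log n' / γ - 1 ≤ k := (Nat.sub_one_lt_floor _).le
    have hNn : B k * (k * m + k * n) ≤ n' := by
      have hBk : (B k : ℝ) ≤ 2 * Real.exp ((θ * s + ε) * k) := by
        have hce := (Nat.ceil_lt_add_one (Real.exp_pos ((θ * s + ε) * k)).le).le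
        have : 1 ≤ Real.exp ((θ * s + ε) * k) := Real.one_le_exp (by positivity)
        simp only [B]
        linarith
      have : (B k * (k * m + k * n) : ℝ) ≤ n' := by
        calc (B k * (k * m + k * n) : ℝ)
            ≤ 2 * Real.exp ((θ * s + ε) * k) * (k * m + k * n) :=
              mul_le_mul_of_nonneg_right hBk (by positivity)
          _ = (2 * (m + n) * (k * Real.exp (-ε * k))) * Real.exp (γ * k) := by
              have : Real.exp ((θ * s + ε) * k) = Real.exp (-ε * k) * Real.exp (γ * k) := by
                rw [← Real.exp_add, hγ]; congr 1; ring
              rw [this]; ring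
          _ ≤ 1 * Real.exp (γ * k) := mul_le_mul_of_nonneg_right h2 (Real.exp_pos _).le
          _ ≤ n' := by
              rw [one_mul, ← Real.le_log_iff_exp_le hn0]; exact hkle
      exact_mod_cast this
    refine le_trans ?_ (H_mono hNn)
    refine le_trans (EReal.coe_le_coe_iff.2 ?_) (not_lt.1 h1)
    rw [div_le_iff₀ hcγ] at h3
    calc c * Real.log n' ≤ 2 * s * (Real.log n' / γ - 1) := by
          have : 2 * s * (Real.log n' / γ - 1) = 2 * s / γ * Real.log n' - 2 * s := by ring
          rw [this]; linarith
      _ ≤ 2 * s * k := mul_le_mul_of_nonneg_left hkge (by linarith)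
      _ = _ := by ring
  · have hρ : 0 < J₀ * Real.log 2 - θ * s := by linarith
    filter_upwards [(tendsto_mul_exp_neg hρ (4 * J₀)).eventually_le_const one_pos,
      eventually_ge_atTop 1] with k h2 hk
    have hk1 : (1 : ℝ) ≤ k := by exact_mod_cast hk
    have hqk := hq k hk
    have hqk0 : 0 < q k := (Real.exp_pos _).trans_le hqk
    have hJq : (1 / 2 : ℝ) ^ (J₀ * k) ≤ q k / (4 * (J₀ * k : ℕ)) := by
      have hJk : (0 : ℝ) < 4 * (J₀ * k : ℕ) := by push_cast; positivity
      rw [le_div_iff₀ hJk]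
      refine le_trans ?_ hqk
      have e : (1 / 2 : ℝ) ^ (J₀ * k) =
          Real.exp (-(J₀ * Real.log 2 - θ * s) * k) * Real.exp (-(θ * s * k)) := by
        rw [← Real.exp_add, one_div, inv_pow, ← Real.exp_log (show (0 : ℝ) < 2 ^ (J₀ * k) by
          positivity), ← Real.exp_neg, Real.log_pow]
        congr 1; push_cast; ring
      rw [e]
      calc _ = 4 * J₀ * (k * Real.exp (-(J₀ * Real.log 2 - θ * s) * k)) *
            Real.exp (-(θ * s * k)) := by push_cast; ring
        _ ≤ 1 * Real.exp (-(θ * s * k)) := mul_le_mul_of_nonneg_right h2 (Real.exp_pos _).le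
        _ = _ := one_mul _
    have hB1 : 1 ≤ B k := Nat.one_le_ceil_iff.2 (Real.exp_pos _)
    have hmain := h.H_lt_le hs (κ := k * κ) (a := k * m) (b := k * n) (s := k * s) (q := q k)
      (J := J₀ * k) (B := B k) (Nat.mul_pos hk hκ) (Nat.mul_le_mul_left k hm)
      (Nat.mul_le_mul_left k hn) rfl (Nat.mul_pos hJ₀pos hk) hJq hB1
    refine hmain.trans ?_
    set w := 4 * ((J₀ * k : ℕ) : ℝ) ^ 2 / (B k * q k) with hw
    have hwle : w ≤ 4 * (J₀ * k : ℝ) ^ 2 * Real.exp (-ε * k) := by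
      have hBq : Real.exp (ε * k) ≤ B k * q k := by
        calc Real.exp (ε * k) = Real.exp ((θ * s + ε) * k) * Real.exp (-(θ * s * k)) := by
              rw [← Real.exp_add]; congr 1; ring
          _ ≤ _ := mul_le_mul (hB k) hqk (Real.exp_pos _).le (by positivity)
      rw [hw, neg_mul, Real.exp_neg, ← div_eq_mul_inv]
      push_cast
      exact div_le_div_of_nonneg_left (by positivity) (Real.exp_pos _) hBq
    have hw0 : 0 ≤ w := by positivity
    have he1 : Real.exp (-ε * k) ≤ 1 := Real.exp_le_one_iff.2 (by
      have := mul_pos hε (show (0 : ℝ) < k by linarith); linarith)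
    have he0 := Real.exp_pos (-ε * k)
    have hsq : w ^ 2 ≤ 16 * (J₀ * k : ℝ) ^ 4 * Real.exp (-ε * k) := by
      calc w ^ 2 ≤ (4 * (J₀ * k : ℝ) ^ 2 * Real.exp (-ε * k)) ^ 2 := pow_le_pow_left₀ hw0 hwle 2
        _ = 16 * (J₀ * k : ℝ) ^ 4 * Real.exp (-ε * k) * Real.exp (-ε * k) := by ring
        _ ≤ 16 * (J₀ * k : ℝ) ^ 4 * Real.exp (-ε * k) * 1 :=
            mul_le_mul_of_nonneg_left he1 (by positivity)
        _ = _ := mul_one _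
    have hlin : 32 * ((J₀ * k : ℕ) : ℝ) ^ 2 * w ≤ 128 * (J₀ * k : ℝ) ^ 4 * Real.exp (-ε * k) := by
      push_cast
      calc 32 * (J₀ * k : ℝ) ^ 2 * w
          ≤ 32 * (J₀ * k : ℝ) ^ 2 * (4 * (J₀ * k : ℝ) ^ 2 * Real.exp (-ε * k)) :=
            mul_le_mul_of_nonneg_left hwle (by positivity)
        _ = _ := by ring
    calc _ ≤ 16 * (J₀ * k : ℝ) ^ 4 * Real.exp (-ε * k) +
          128 * (J₀ * k : ℝ) ^ 4 * Real.exp (-ε * k) := add_le_add hsq hlin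
      _ = _ := by ring

/-- Almost surely, `τ |z_*|` is eventually at least every multiple of `log n` below
`2 θ₁ / θ - 2`, if `ψ(θ₁) < τ` and `ψ` is positive at points above and close to `θ`. -/
lemma IsLetterModel.ae_eventually_le_card (h : IsLetterModel P μ X Y) (hs : IsScoring K g M)
    (ord : LinearOrder Alignment) (hθ : 0 < θ)
    (hpos : ∀ t : ℝ, θ < t → ∃ θ', θ < θ' ∧ θ' < t ∧ 0 < psi P X Y K g θ') {θ₁ τ d : ℝ}
    (hθ₁ : 0 < θ₁) (hτ : psi P X Y K g θ₁ < τ) (hd : d < θ₁ * (2 / θ) - 2) :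
    ∀ᵐ ω ∂P, ∀ᶠ n : ℕ in atTop, d * Real.log n ≤
      τ * (optimalAlignment ord K g (fun i => X i ω) (fun j => Y j ω) n).card := by
  set ε := (θ₁ * (2 / θ) - 2 - d) / 2 with hεdef
  have hε : 0 < ε := by rw [hεdef]; linarith
  -- Choose `c` so close to `2 / θ` that `c θ₁ - 2 - ε` still exceeds `d`; the maximum with `0` only
  -- ensures `c > 0`.
  obtain ⟨c, hc1, hc2⟩ := exists_between
    (show max 0 ((d + 2 + ε) / θ₁) < 2 / θ from max_lt (by positivity) (by
      rw [div_lt_iff₀ hθ₁, mul_comm]; linarith))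
  have hc0 : 0 < c := (le_max_left _ _).trans_lt hc1
  have hcd : d + 2 + ε < c * θ₁ := by
    rw [← div_lt_iff₀ hθ₁]; exact (le_max_right _ _).trans_lt hc1
  obtain ⟨t, ht1, ht2⟩ := exists_between
    (show θ < 2 / c by rw [lt_div_iff₀ hc0, mul_comm]; rwa [lt_div_iff₀ hθ] at hc2)
  obtain ⟨θ', h1, h2, h3⟩ := hpos t ht1
  have hct : c * t < 2 := by rwa [lt_div_iff₀ hc0, mul_comm] at ht2
  filter_upwards [h.ae_eventually_le_H hs (hθ.trans h1) h3 h2 hc0 hct,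
    h.ae_eventually_score_le hs hθ₁ hτ hε] with ω hω1 hω2
  filter_upwards [hω1, hω2, eventually_ge_atTop 1] with n hn1 hn2 hn
  obtain ⟨hfit, hopt⟩ := optimalAlignment_spec (K := K) (g := g) (x := fun i => X i ω)
    (y := fun j => Y j ω) ord hn
  have hle := hn2 _ hfit
  rw [← hopt, EReal.coe_le_coe_iff] at hn1
  have hlog : 0 ≤ Real.log n := Real.log_nonneg (by exact_mod_cast hn)
  have := mul_le_mul_of_nonneg_left hn1 hθ₁.le
  have := mul_le_mul_of_nonneg_right hcd.le hlog
  linarith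

/-- The strong law for the number of matches at a zero of `ψ` with positive derivative. -/
lemma IsLetterModel.ae_tendsto_card (h : IsLetterModel P μ X Y) (hs : IsScoring K g M)
    (ord : LinearOrder Alignment) (hθ : 0 < θ) (h0 : psi P X Y K g θ = 0) {D : ℝ} (hD : 0 < D)
    (hderiv : HasDerivAt (psi P X Y K g) D θ) :
    ∀ᵐ ω ∂P, Tendsto (fun n : ℕ =>
      ((optimalAlignment ord K g (fun i => X i ω) (fun j => Y j ω) n).card : ℝ) / Real.log n)
      atTop (𝓝 (2 / (θ * D))) := by
  have hslope := hasDerivAt_iff_tendsto_slope.1 hderiv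
  have hslope_eq : ∀ t, slope (psi P X Y K g) θ t = psi P X Y K g t / (t - θ) := fun t => by
    rw [slope_def_field, h0, sub_zero]
  have hgt := hslope.mono_left (nhdsGT_le_nhdsNE θ)
  have hlt := hslope.mono_left (nhdsLT_le_nhdsNE θ)
  have hpos : ∀ t : ℝ, θ < t → ∃ θ', θ < θ' ∧ θ' < t ∧ 0 < psi P X Y K g θ' := by
    intro t ht
    obtain ⟨θ', h1, h2⟩ := ((hgt.eventually_const_lt hD).and (Ioo_mem_nhdsGT ht)).exists
    rw [hslope_eq] at h1
    exact ⟨θ', h2.1, h2.2, (div_pos_iff_of_pos_right (sub_pos.2 h2.1)).1 h1⟩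
  have hlogn : Tendsto (fun n : ℕ => Real.log n) atTop atTop :=
    Real.tendsto_log_atTop.comp tendsto_natCast_atTop_atTop
  have hlim0 : 0 < 2 / (θ * D) := by positivity
  have hlower : ∀ a : ℝ, a < 2 / (θ * D) → ∀ᵐ ω ∂P, ∀ᶠ n : ℕ in atTop, a <
      ((optimalAlignment ord K g (fun i => X i ω) (fun j => Y j ω) n).card : ℝ) /
        Real.log n := by
    intro a₀ ha₀
    obtain ⟨a, ha1, ha2⟩ := exists_between (max_lt ha₀ hlim0)
    have ha0 : 0 < a := (le_max_right _ _).trans_lt ha1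
    have hDa : D < 2 / (θ * a) := by
      rw [lt_div_iff₀ (by positivity)] at ha2 ⊢; linarith
    -- To the right of `θ` the secant slope is below `2 / (θ a)`, so a positive `τ > ψ(θ₁)` exists
    -- with `a τ < 2 θ₁ / θ - 2`.
    obtain ⟨θ₁, ⟨h1, h2⟩, h3⟩ := (((hgt.eventually_lt_const hDa).and
      (hgt.eventually_const_lt hD)).and self_mem_nhdsWithin).exists
    have h3' : 0 < θ₁ - θ := sub_pos.2 h3
    rw [hslope_eq, div_lt_iff₀ h3'] at h1
    rw [hslope_eq] at h2
    replace h2 := (div_pos_iff_of_pos_right h3').1 h2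
    obtain ⟨τ, hτ1, hτ2⟩ := exists_between h1
    have hτ0 := h2.trans hτ1
    have hd : a * τ < θ₁ * (2 / θ) - 2 := by
      have e : θ₁ * (2 / θ) - 2 = a * (2 / (θ * a) * (θ₁ - θ)) := by field_simp
      rw [e]
      exact mul_lt_mul_of_pos_left hτ2 ha0
    filter_upwards [h.ae_eventually_le_card hs ord hθ hpos (hθ.trans h3) hτ1 hd] with ω hω
    filter_upwards [hω, hlogn.eventually_gt_atTop 0] with n hn hlog
    refine ((le_max_left _ _).trans_lt ha1).trans_le ?_
    rw [le_div_iff₀ hlog]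
    refine le_of_mul_le_mul_left ?_ hτ0
    linarith
  have hupper : ∀ b : ℝ, 2 / (θ * D) < b → ∀ᵐ ω ∂P, ∀ᶠ n : ℕ in atTop,
      ((optimalAlignment ord K g (fun i => X i ω) (fun j => Y j ω) n).card : ℝ) /
        Real.log n < b := by
    intro b hb
    have hb0 : 0 < b := hlim0.trans hb
    have hDb : 2 / (θ * b) < D := by
      rw [div_lt_iff₀ (by positivity)] at hb ⊢; linarith
    -- To the left of `θ` a suitable `τ` is negative, so the same inequality bounds the number of
    -- matches from above.
    obtain ⟨θ₁, h1, h3⟩ := ((hlt.eventually_const_lt hDb).and (Ioo_mem_nhdsLT hθ)).exists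
    have h3' : θ₁ - θ < 0 := sub_neg.2 h3.2
    rw [hslope_eq, lt_div_iff_of_neg h3'] at h1
    obtain ⟨τ, hτ1, hτ2⟩ := exists_between h1
    have hτ0 : τ < 0 := hτ2.trans (mul_neg_of_pos_of_neg (by positivity) h3')
    have hd : b * τ < θ₁ * (2 / θ) - 2 := by
      have e : θ₁ * (2 / θ) - 2 = b * (2 / (θ * b) * (θ₁ - θ)) := by field_simp
      rw [e]
      exact mul_lt_mul_of_pos_left hτ2 hb0
    obtain ⟨d, hd1, hd2⟩ := exists_between hd
    filter_upwards [h.ae_eventually_le_card hs ord hθ hpos h3.1 hτ1 hd2] with ω hω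
    filter_upwards [hω, hlogn.eventually_gt_atTop 0] with n hn hlog
    rw [div_lt_iff₀ hlog]
    by_contra hge
    push Not at hge
    have := mul_le_mul_of_nonpos_left hge hτ0.le
    have := mul_lt_mul_of_pos_right hd1 hlog
    linarith
  -- Rational bounds keep the union of exceptional null sets countable.
  have hae1 := ae_all_iff.2 fun r : ℚ => ae_all_iff.2 fun hr : (r : ℝ) < 2 / (θ * D) => hlower r hr
  have hae2 := ae_all_iff.2 fun r : ℚ => ae_all_iff.2 fun hr : 2 / (θ * D) < (r : ℝ) => hupper r hr
  filter_upwards [hae1, hae2] with ω hω1 hω2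
  refine tendsto_order.2 ⟨fun a ha => ?_, fun b hb => ?_⟩
  · obtain ⟨r, hr1, hr2⟩ := exists_rat_btwn ha
    exact (hω1 r hr2).mono fun n hn => hr1.trans hn
  · obtain ⟨r, hr1, hr2⟩ := exists_rat_btwn hb
    exact (hω2 r hr1).mono fun n hn => hn.trans hr2

end StrongLaw

end LocalAlignment

end

theorem theorem3
    {A : Type*} [Fintype A] [MeasurableSpace A] [MeasurableSingletonClass A]
    {Ω : Type*} [MeasurableSpace Ω] (P : Measure Ω) [IsProbabilityMeasure P]
    -- the letter distribution and the two random sequences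
    (μ : Measure A) (hμ : ∀ a, 0 < μ {a})
    (X Y : ℕ → Ω → A)
    (hX : ∀ i, Measurable (X i)) (hY : ∀ j, Measurable (Y j))
    (hXμ : ∀ i, P.map (X i) = μ) (hYμ : ∀ j, P.map (Y j) = μ)
    (hindep : iIndepFun (Sum.elim X Y) P)
    -- the similarity matrix
    (K : A → A → ℝ) (hKsymm : ∀ a b, K a b = K b a)
    (hKmean : ∫ ω, K (X 0 ω) (Y 0 ω) ∂P < 0) (hKmax : ∃ a b, 0 < K a b)
    -- the gap penalty
    (g : ℕ → ℝ) (hg0 : g 0 = 0) (hgmono : Monotone g)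
    (hgconcave : ∀ k, g (k + 2) - g (k + 1) ≤ g (k + 1) - g k)
    (hglog : Tendsto (fun k : ℕ => g k / Real.log k) atTop atTop)
    -- the ordering of the candidate alignments
    (ord : LinearOrder LocalAlignment.Alignment) :
    -- the function `ψ` is well defined and finite on `(0, ∞)`
    (∀ t : ℝ, 0 < t →
      (∀ κ : ℕ, 1 ≤ κ → Summable fun r : ℕ × ℕ =>
        LocalAlignment.expMoment P X Y K g κ (κ + r.1) (κ + r.2) t) ∧
      Tendsto (fun κ : ℕ => LocalAlignment.psiK P X Y K g κ t / κ) atTop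
        (𝓝 (LocalAlignment.psi P X Y K g t))) ∧
    -- if `θ` is the unique positive root of `ψ` and `ψ` is differentiable there
    ∀ θ : ℝ, 0 < θ → LocalAlignment.psi P X Y K g θ = 0 →
      (∀ t : ℝ, 0 < t → LocalAlignment.psi P X Y K g t = 0 → t = θ) →
      DifferentiableAt ℝ (LocalAlignment.psi P X Y K g) θ →
      -- then the derivative is positive and the number of matches obeys the strong law
      0 < deriv (LocalAlignment.psi P X Y K g) θ ∧
      ∀ᵐ ω ∂P, Tendsto
        (fun n : ℕ =>
          ((LocalAlignment.optimalAlignment ord K g (fun i => X i ω) (fun j => Y j ω) n).card : ℝ) /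
            Real.log n)
        atTop (𝓝 (2 / (θ * deriv (LocalAlignment.psi P X Y K g) θ))) := by
  obtain ⟨M, hM0, hM⟩ : ∃ M : ℝ, 0 < M ∧ ∀ a b, |K a b| ≤ M := by
    refine ⟨∑ a, ∑ b, |K a b| + 1, by positivity, fun a b => ?_⟩
    have h1 := Finset.single_le_sum (f := fun b => |K a b|) (fun b _ => abs_nonneg _)
      (Finset.mem_univ b)
    have h2 := Finset.single_le_sum (f := fun a => ∑ b, |K a b|)
      (fun a _ => Finset.sum_nonneg fun b _ => abs_nonneg _) (Finset.mem_univ a)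
    linarith
  have hmodel : LocalAlignment.IsLetterModel P μ X Y := ⟨hX, hY, hXμ, hYμ, hindep⟩
  have hscoring : LocalAlignment.IsScoring K g M :=
    ⟨hKsymm, hM0, fun a b => (abs_le.1 (hM a b)).2, fun a b => (abs_le.1 (hM a b)).1, hg0, hgmono,
      LocalAlignment.subadditive_of_concave hg0 hgconcave, hglog⟩
  refine ⟨fun t ht => ⟨fun κ hκ => hmodel.summable_expMoment hscoring hκ ht,
    hmodel.tendsto_psi hscoring ht⟩, fun θ hθ h0 huniq hd => ?_⟩
  have hpos := hmodel.deriv_psi_pos hscoring hθ h0 huniq hd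
  exact ⟨hpos, hmodel.ae_tendsto_card hscoring ord hθ h0 hpos hd.hasDerivAt⟩
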